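/- Let $\mathscr P^{S_\infty}(\mathbb Z)$ be the ring of symmetric functions in superspace over $\mathbb Z$ in infinitely many commuting variables $x_1,x_2,\dots$ and anticommuting variables $\theta_1,\theta_2,\dots$ (with $\theta_i^2=0$ and $x_i\theta_j=\theta_jx_i$): its elements are the families $(f_N)_{N\ge 0}$ of bounded degree in which $f_N$ is a polynomial in $x_1,\dots,x_N,\theta_1,\dots,\theta_N$ invariant under the diagonal action $x_i\mapsto x_{\sigma(i)}$, $\theta_i\mapsto\theta_{\sigma(i)}$ of $S_N$, and $f_{N+1}|_{x_{N+1}=\theta_{N+1}=0}=f_N$. A superpartition is a pair $\Lambda=(\Lambda_1,\dots,\Lambda_m;\Lambda_{m+1},\dots,\Lambda_\ell)$ with $\Lambda_1>\dots>\Lambda_m\ge 0$ and $\Lambda_{m+1}\ge\dots\ge\Lambda_\ell>0$; put $|\Lambda|=\sum_i\Lambda_i$, $\overline{\underline{\Lambda}}=m$ (the fermionic degree) and $\ell(\Lambda)=\ell$, and write $\Lambda\vdash(n|m)$ if $|\Lambda|=n$ and $\overline{\underline\Lambda}=m$. Let $m_\Lambda$ be the sum of the distinct terms obtained from $\theta_1\cdots\theta_m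 x_1^{\Lambda_1}\cdots x_\ell^{\Lambda_\ell}$ by simultaneously permuting the $x_i$ and the $\theta_i$. For $n\ge 0$ let $$e_n=\sum_{j_1<\dots<j_n}x_{j_1}\cdots x_{j_n},\qquad \tilde e_n=\sum_{i}\ \sum_{\substack{j_1<\dots<j_n\\ i\notin\{j_1,\dots,j_n\}}}\theta_i\,x_{j_1}\cdots x_{j_n},$$ $$h_n=\sum_{\lambda\vdash n}m_\lambda,\qquad \tilde h_n=\sum_{\Lambda\vdash(n|1)}(\Lambda_1+1)\,m_\Lambda,$$ $$p_n=\sum_i x_i^n\ (n\ge1),\quad p_0=0,\qquad \tilde p_n=\sum_i\theta_ix_i^n ,$$ and for a superpartition $\Lambda$ let $p_\Lambda=\tilde p_{\Lambda_1}\cdots\tilde p_{\Lambda_m}\,p_{\Lambda_{m+1}}\cdots p_{\Lambda_\ell}$ (product from left to right). Theorem. There is exactly one ring homomorphism $\hat\omega:\mathscr P^{S_\infty}(\mathbb Z)\to\mathscr P^{S_\infty}(\mathbb Z)$ with $\hat\omega(e_n)=h_n$ and $\hat\omega(\tilde e_n)=\tilde h_n$ for all $n\ge 0$. For all $n>0$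 it satisfies $$\hat\omega(p_n)=(-1)^{n-1}p_n\qquad\text{and}\qquad \hat\omega(\tilde p_{n-1})=(-1)^{n-1}\tilde p_{n-1},$$ and, equivalently, for every superpartition $\Lambda$, $$\hat\omega(p_\Lambda)=(-1)^{|\Lambda|+\overline{\underline{\Lambda}}-\ell(\Lambda)}\,p_\Lambda .$$ -/

import Mathlib

open Finset
open scoped TensorProduct

noncomputable section

namespace SuperSym

/-! ## Polynomials in superspace in `N` pairs of variables -/

/-- Polynomials in `x_1, …, x_N` (commuting) and `θ_1, …, θ_N` (anticommuting, of square zero) with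
coefficients in `A`: the Grassmann algebra on `N` generators over the polynomial ring in
`N` variables. The `x_i` commute with the `θ_j`. -/
abbrev SuperPoly (A : Type*) [CommRing A] (N : ℕ) : Type _ :=
  MvPolynomial (Fin N) A ⊗[A] ExteriorAlgebra A (Fin N → A)

/-- The Grassmann variable `θ_i`, as an element of the Grassmann algebra. -/
def theta (A : Type*) [CommRing A] {N : ℕ} (i : Fin N) : ExteriorAlgebra A (Fin N → A) :=
  ExteriorAlgebra.ι A (Pi.single i 1)

/-- The ordered product `θ_{j_1} ⋯ θ_{j_m}`. -/
def thetaProd (A : Type*) [CommRing A] {N m : ℕ} (j : Fin m → Fin N) :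
    ExteriorAlgebra A (Fin N → A) :=
  (List.ofFn fun k => theta A (j k)).prod

/-- The diagonal action of a permutation: `x_i ↦ x_{σ i}` and `θ_i ↦ θ_{σ i}`. -/
def permAct (A : Type*) [CommRing A] {N : ℕ} (σ : Equiv.Perm (Fin N)) :
    SuperPoly A N →ₐ[A] SuperPoly A N :=
  Algebra.TensorProduct.map (MvPolynomial.rename σ)
    (ExteriorAlgebra.map (LinearMap.funLeft A A σ.symm))

/-- Setting the last pair of variables to zero, `x_{N+1} = 0` and `θ_{N+1} = 0`. -/
def restr (A : Type*) [CommRing A] (N : ℕ) : SuperPoly A (N + 1) →ₐ[A] SuperPoly A N :=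
  Algebra.TensorProduct.map
    (MvPolynomial.aeval (Fin.snoc (α := fun _ => MvPolynomial (Fin N) A) MvPolynomial.X 0))
    (ExteriorAlgebra.map (LinearMap.funLeft A A Fin.castSucc))

/-- The superpolynomials of degree at most `d` in the `x_i` and at most `d` in the `θ_i`. -/
def degLE (A : Type*) [CommRing A] (N d : ℕ) : Submodule A (SuperPoly A N) :=
  Submodule.span A {f | ∃ (p : MvPolynomial (Fin N) A) (w : ExteriorAlgebra A (Fin N → A)),
    p.totalDegree ≤ d ∧ (∃ m ≤ d, w ∈ ⋀[A]^m (Fin N → A)) ∧ f = p ⊗ₜ[A] w}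

section Basic

variable {A : Type*} [CommRing A] {N : ℕ}

theorem totalDegree_X_pow_le (i : Fin N) (n : ℕ) :
    (MvPolynomial.X i ^ n : MvPolynomial (Fin N) A).totalDegree ≤ n := by
  rw [MvPolynomial.X_pow_eq_monomial]
  exact (MvPolynomial.totalDegree_monomial_le _ _).trans (by simp)

theorem tmul_mem_degLE {d m : ℕ} {p : MvPolynomial (Fin N) A}
    {w : ExteriorAlgebra A (Fin N → A)} (hp : p.totalDegree ≤ d) (hm : m ≤ d)
    (hw : w ∈ ⋀[A]^m (Fin N → A)) : p ⊗ₜ[A] w ∈ degLE A N d :=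
  Submodule.subset_span ⟨p, w, hp, ⟨m, hm, hw⟩, rfl⟩

theorem degLE_mono {d d' : ℕ} (h : d ≤ d') : degLE A N d ≤ degLE A N d' := by
  refine Submodule.span_mono ?_
  rintro f ⟨p, w, hp, ⟨m, hm, hw⟩, rfl⟩
  exact ⟨p, w, hp.trans h, ⟨m, hm.trans h, hw⟩, rfl⟩

theorem mul_mem_degLE {d d' : ℕ} {f g : SuperPoly A N} (hf : f ∈ degLE A N d)
    (hg : g ∈ degLE A N d') : f * g ∈ degLE A N (d + d') := by
  have h := Submodule.mul_mem_mul hf hg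
  rw [degLE, degLE, Submodule.span_mul_span] at h
  refine Submodule.span_mono ?_ h
  rintro _ ⟨_, ⟨p, w, hp, ⟨m, hm, hw⟩, rfl⟩, _, ⟨q, v, hq, ⟨l, hl, hv⟩, rfl⟩, rfl⟩
  refine ⟨p * q, w * v, (MvPolynomial.totalDegree_mul p q).trans (add_le_add hp hq),
    ⟨m + l, add_le_add hm hl, ?_⟩, by simp [Algebra.TensorProduct.tmul_mul_tmul]⟩
  change w * v ∈ (LinearMap.range (ExteriorAlgebra.ι A : (Fin N → A) →ₗ[A] _)) ^ (m + l)
  rw [pow_add]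
  exact Submodule.mul_mem_mul hw hv

theorem algebraMap_mem_degLE (a : A) (d : ℕ) :
    algebraMap A (SuperPoly A N) a ∈ degLE A N d := by
  rw [Algebra.TensorProduct.algebraMap_apply]
  refine tmul_mem_degLE (m := 0) (by simp) (Nat.zero_le d) ?_
  change _ ∈ (LinearMap.range (ExteriorAlgebra.ι A : (Fin N → A) →ₗ[A] _)) ^ 0
  rw [pow_zero]
  exact Submodule.one_le.mp le_rfl

theorem thetaProd_mem {m : ℕ} (j : Fin m → Fin N) : thetaProd A j ∈ ⋀[A]^m (Fin N → A) := by
  have h := ExteriorAlgebra.ιMulti_apply (R := A) (fun k => (Pi.single (j k) 1 : Fin N → A))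
  rw [thetaProd]
  simp only [theta]
  rw [← h]
  exact ExteriorAlgebra.ιMulti_range A m ⟨_, rfl⟩

theorem theta_mem (i : Fin N) : theta A i ∈ ⋀[A]^1 (Fin N → A) := by
  simpa [thetaProd] using thetaProd_mem (A := A) (fun _ : Fin 1 => i)

theorem map_perm_theta (σ : Equiv.Perm (Fin N)) (i : Fin N) :
    ExteriorAlgebra.map (LinearMap.funLeft A A σ.symm) (theta A i) = theta A (σ i) := by
  rw [theta, theta, ExteriorAlgebra.map_apply_ι]
  congr 1
  ext k
  by_cases h : k = σ i
  · subst h; simp [LinearMap.funLeft_apply]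
  · have : σ.symm k ≠ i := fun h' => h (by simp [← h'])
    simp [LinearMap.funLeft_apply, h, this]

theorem map_castSucc_theta (i : Fin N) :
    ExteriorAlgebra.map (LinearMap.funLeft A A Fin.castSucc) (theta A i.castSucc) =
      theta A i := by
  rw [theta, theta, ExteriorAlgebra.map_apply_ι]
  congr 1
  ext k
  simp [LinearMap.funLeft_apply, Pi.single_apply]

theorem map_castSucc_theta_last :
    ExteriorAlgebra.map (LinearMap.funLeft A A Fin.castSucc) (theta A (Fin.last N)) = 0 := by
  rw [theta, ExteriorAlgebra.map_apply_ι]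
  have : LinearMap.funLeft A A Fin.castSucc (Pi.single (Fin.last N) 1 : Fin (N + 1) → A) = 0 := by
    ext k
    simp [LinearMap.funLeft_apply, Fin.castSucc_ne_last]
  rw [this, map_zero]

theorem map_perm_thetaProd {m : ℕ} (σ : Equiv.Perm (Fin N)) (j : Fin m → Fin N) :
    ExteriorAlgebra.map (LinearMap.funLeft A A σ.symm) (thetaProd A j) =
      thetaProd A (fun k => σ (j k)) := by
  simp only [thetaProd, map_list_prod, List.map_ofFn, Function.comp_def, map_perm_theta]

theorem map_castSucc_thetaProd {m : ℕ} (j : Fin m → Fin N) :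
    ExteriorAlgebra.map (LinearMap.funLeft A A Fin.castSucc)
      (thetaProd A (fun k => (j k).castSucc)) = thetaProd A j := by
  simp only [thetaProd, map_list_prod, List.map_ofFn, Function.comp_def, map_castSucc_theta]

theorem map_castSucc_thetaProd_last {m : ℕ} (j : Fin m → Fin (N + 1)) (k : Fin m)
    (hk : j k = Fin.last N) :
    ExteriorAlgebra.map (LinearMap.funLeft A A Fin.castSucc) (thetaProd A j) = 0 := by
  simp only [thetaProd, map_list_prod, List.map_ofFn, Function.comp_def]
  refine List.prod_eq_zero ?_
  rw [List.mem_ofFn]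
  exact ⟨k, by rw [hk, map_castSucc_theta_last]⟩

end Basic

/-! ## Symmetric functions in superspace -/

/-- The ring of symmetric superfunctions in infinitely many variables: sequences of `S_N`-invariant
superpolynomials in `N` pairs of variables, `N = 0, 1, 2, …`, compatible with setting the last pair
of variables to zero, and of bounded degree. -/
def SymSuper (A : Type*) [CommRing A] : Subalgebra A (∀ N : ℕ, SuperPoly A N) where
  carrier := {f | (∀ (N : ℕ) (σ : Equiv.Perm (Fin N)), permAct A σ (f N) = f N) ∧
    (∀ N : ℕ, restr A N (f (N + 1)) = f N) ∧ ∃ d : ℕ, ∀ N : ℕ, f N ∈ degLE A N d}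
  mul_mem' := by
    rintro f g ⟨hf, hf', d, hd⟩ ⟨hg, hg', d', hd'⟩
    refine ⟨fun N σ => ?_, fun N => ?_, d + d', fun N => mul_mem_degLE (hd N) (hd' N)⟩
    · rw [Pi.mul_apply, map_mul, hf, hg]
    · rw [Pi.mul_apply, map_mul, hf', hg', Pi.mul_apply]
  add_mem' := by
    rintro f g ⟨hf, hf', d, hd⟩ ⟨hg, hg', d', hd'⟩
    refine ⟨fun N σ => ?_, fun N => ?_, d + d', fun N => ?_⟩
    · rw [Pi.add_apply, map_add, hf, hg]
    · rw [Pi.add_apply, map_add, hf', hg', Pi.add_apply]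
    · exact Submodule.add_mem _ (degLE_mono (Nat.le_add_right d d') (hd N))
        (degLE_mono (Nat.le_add_left d' d) (hd' N))
  algebraMap_mem' := by
    intro a
    refine ⟨fun N σ => ?_, fun N => ?_, 0, fun N => ?_⟩
    · rw [Pi.algebraMap_apply, AlgHom.commutes]
    · rw [Pi.algebraMap_apply, AlgHom.commutes, Pi.algebraMap_apply]
    · exact algebraMap_mem_degLE a 0

/-! ## Superpartitions -/

/-- A superpartition `Λ = (Λ^a; Λ^s)`: `Λ^a` is a strictly decreasing sequence of non-negative
integers and `Λ^s` is a partition (written without its zero entries). -/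
structure Superpartition where
  /-- the antisymmetric component `Λ^a` -/
  anti : List ℕ
  /-- the symmetric component `Λ^s` -/
  sym : List ℕ
  anti_strict : anti.Pairwise (· > ·)
  sym_weak : sym.Pairwise (· ≥ ·)
  sym_pos : ∀ k ∈ sym, 0 < k

/-- The bosonic degree `|Λ|`, the sum of all entries. -/
def Superpartition.degree (Λ : Superpartition) : ℕ := Λ.anti.sum + Λ.sym.sum

/-- The fermionic degree `m`, the number of entries of `Λ^a`. -/
def Superpartition.fermionicDegree (Λ : Superpartition) : ℕ := Λ.anti.length

/-- The length `ℓ(Λ)`: a zero entry of `Λ^a` counts. -/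
def Superpartition.length (Λ : Superpartition) : ℕ := Λ.fermionicDegree + Λ.sym.length

/-- The superpartition `(; μ)`. -/
def bosonic {n : ℕ} (μ : n.Partition) : Superpartition where
  anti := []
  sym := μ.parts.sort (· ≥ ·)
  anti_strict := List.Pairwise.nil
  sym_weak := Multiset.pairwise_sort _ _
  sym_pos := fun k hk => μ.parts_pos (by simpa using hk)

/-- The superpartition `(k; μ)`. -/
def oneFermion (k : ℕ) {n : ℕ} (μ : n.Partition) : Superpartition where
  anti := [k]
  sym := μ.parts.sort (· ≥ ·)
  anti_strict := List.pairwise_singleton _ _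
  sym_weak := Multiset.pairwise_sort _ _
  sym_pos := fun k hk => μ.parts_pos (by simpa using hk)

/-! ## Monomial symmetric functions -/

/-- The distinct terms `θ_{j_1} ⋯ θ_{j_m} x^a` of `m_Λ` in `N` variables: the exponent of `x_{j_k}`
is the `k`-th entry of `Λ^a`, and the nonzero exponents of the other variables are, up to order, the
entries of `Λ^s`. As `Λ^a` has distinct entries, each term occurs for only one `j`. -/
def monIndex (Λ : Superpartition) (N : ℕ) :
    Finset ((Fin Λ.anti.length ↪ Fin N) × (Fin N → ℕ)) :=
  (univ ×ˢ piAntidiag univ Λ.degree).filter fun t =>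
    (∀ k, t.2 (t.1 k) = Λ.anti.get k) ∧
      (univ.filter fun i => (∀ k, t.1 k ≠ i) ∧ 0 < t.2 i).val.map t.2 = (Λ.sym : Multiset ℕ)

/-- `m_Λ` in `N` pairs of variables, the sum of its distinct terms. -/
def mPoly (A : Type*) [CommRing A] (Λ : Superpartition) (N : ℕ) : SuperPoly A N :=
  ∑ t ∈ monIndex Λ N, (∏ i, MvPolynomial.X i ^ t.2 i) ⊗ₜ[A] thetaProd A t.1

section Mon

variable {A : Type*} [CommRing A] {N : ℕ}

theorem monIndex_iff (Λ : Superpartition) {M : ℕ} (e : Fin N ↪ Fin M)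
    (j : Fin Λ.anti.length ↪ Fin N) (a : Fin N → ℕ) (b : Fin M → ℕ)
    (hb : ∀ i, b (e i) = a i) (hb0 : ∀ i, i ∉ Set.range e → b i = 0) :
    (j.trans e, b) ∈ monIndex Λ M ↔ (j, a) ∈ monIndex Λ N := by
  have h : (univ.filter fun i => (∀ k, (j.trans e) k ≠ i) ∧ 0 < b i) =
      (univ.filter fun i => (∀ k, j k ≠ i) ∧ 0 < a i).map e := by
    ext i
    simp only [mem_filter, mem_univ, true_and, mem_map, Function.Embedding.trans_apply]
    constructor
    · rintro ⟨h1, h2⟩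
      have hi : i ∈ Set.range e := by
        by_contra hi
        exact h2.ne' (hb0 i hi)
      obtain ⟨l, rfl⟩ := hi
      exact ⟨l, ⟨fun k hk => h1 k (by rw [hk]), by rwa [← hb]⟩, rfl⟩
    · rintro ⟨l, ⟨h1, h2⟩, rfl⟩
      exact ⟨fun k hk => h1 k (e.injective hk), by rwa [hb]⟩
  have hs : ∑ i, b i = ∑ i, a i := by
    symm
    exact Finset.sum_of_injOn e e.injective.injOn (fun _ _ => by simp)
      (fun i _ hi => hb0 i (by simpa using hi)) (fun i _ => (hb i).symm)
  have hm : ((univ.filter fun i => (∀ k, (j.trans e) k ≠ i) ∧ 0 < b i).val.map b) =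
      (univ.filter fun i => (∀ k, j k ≠ i) ∧ 0 < a i).val.map a := by
    rw [h, Finset.map_val, Multiset.map_map]
    exact Multiset.map_congr rfl (fun i _ => hb i)
  simp only [monIndex, mem_filter, mem_product, mem_univ, true_and, mem_piAntidiag, hm, hs]
  simp [hb]

theorem permAct_mPoly (Λ : Superpartition) (σ : Equiv.Perm (Fin N)) :
    permAct A σ (mPoly A Λ N) = mPoly A Λ N := by
  rw [mPoly, map_sum]
  refine Finset.sum_equiv ((Equiv.embeddingCongr (Equiv.refl _) σ).prodCongr
    (Equiv.arrowCongr σ (Equiv.refl ℕ))) (fun t => ?_) (fun t _ => ?_)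
  · exact (monIndex_iff Λ σ.toEmbedding t.1 t.2 (t.2 ∘ σ.symm) (by simp)
      (fun i hi => absurd ⟨σ.symm i, by simp⟩ hi)).symm
  · rw [permAct, Algebra.TensorProduct.map_tmul, map_perm_thetaProd, map_prod]
    simp only [map_pow, MvPolynomial.rename_X]
    congr 1
    rw [← Equiv.prod_comp σ (fun i => MvPolynomial.X i ^ _)]
    simp [Equiv.arrowCongr]

theorem restr_X_castSucc (i : Fin N) :
    MvPolynomial.aeval (R := A) (Fin.snoc (α := fun _ => MvPolynomial (Fin N) A)
      MvPolynomial.X 0) (MvPolynomial.X i.castSucc) = MvPolynomial.X i := by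
  rw [MvPolynomial.aeval_X, Fin.snoc_castSucc]

theorem restr_X_last :
    MvPolynomial.aeval (R := A) (Fin.snoc (α := fun _ => MvPolynomial (Fin N) A)
      MvPolynomial.X 0) (MvPolynomial.X (Fin.last N)) = 0 := by
  rw [MvPolynomial.aeval_X, Fin.snoc_last]

theorem restr_mPoly (Λ : Superpartition) (N : ℕ) :
    restr A N (mPoly A Λ (N + 1)) = mPoly A Λ N := by
  have hr : ∀ i : Fin (N + 1), i ∉ Set.range (Fin.castSuccEmb : Fin N ↪ Fin (N + 1)) →
      i = Fin.last N := by
    intro i hi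
    by_contra h
    exact hi ⟨i.castPred h, by simp⟩
  rw [mPoly, mPoly, map_sum]
  symm
  refine Finset.sum_of_injOn (fun t => (t.1.trans Fin.castSuccEmb,
    (Fin.snoc (α := fun _ => ℕ) t.2 0 : Fin (N + 1) → ℕ))) ?_ ?_ ?_ ?_
  · rintro ⟨j, a⟩ - ⟨j', a'⟩ - h
    simp only [Prod.mk.injEq] at h
    refine Prod.ext ?_ ?_
    · ext k
      have := DFunLike.congr_fun h.1 k
      simpa [Fin.ext_iff] using this
    · have := congrArg (Fin.init (α := fun _ => ℕ)) h.2
      simpa only [Fin.init_snoc] using this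
  · rintro ⟨j, a⟩ ht
    refine (monIndex_iff Λ Fin.castSuccEmb j a _ (fun i => by simp) (fun i hi => ?_)).mpr ht
    rw [hr i hi, Fin.snoc_last]
  · rintro ⟨j, b⟩ ht hn
    rw [restr, Algebra.TensorProduct.map_tmul]
    by_cases hj : ∃ k, j k = Fin.last N
    · obtain ⟨k, hk⟩ := hj
      rw [map_castSucc_thetaProd_last _ k hk, TensorProduct.tmul_zero]
    by_cases hb : b (Fin.last N) = 0
    · push Not at hj
      refine absurd ?_ hn
      refine ⟨(⟨fun k => (j k).castPred (hj k), fun k l h => ?_⟩, Fin.init b), ?_, ?_⟩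
      · simpa using h
      · refine (monIndex_iff Λ Fin.castSuccEmb _ _ b (fun i => rfl) (fun i hi => ?_)).mp ?_
        · rw [hr i hi, hb]
        · convert ht using 2
          ext k
          rfl
      · refine Prod.ext ?_ ?_
        · ext k
          rfl
        · change Fin.snoc (α := fun _ => ℕ) (Fin.init b) 0 = b
          rw [← hb]
          exact Fin.snoc_init_self b
    · rw [map_prod, Finset.prod_eq_zero (mem_univ (Fin.last N)), TensorProduct.zero_tmul]
      rw [map_pow, restr_X_last, zero_pow hb]
  · rintro ⟨j, a⟩ -
    rw [restr, Algebra.TensorProduct.map_tmul]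
    congr 1
    · rw [map_prod, Fin.prod_univ_castSucc]
      simp only [map_pow, restr_X_castSucc, Fin.snoc_castSucc, Fin.snoc_last, pow_zero, map_one, mul_one]
    · exact (map_castSucc_thetaProd j).symm

theorem mPoly_mem_degLE (Λ : Superpartition) :
    mPoly A Λ N ∈ degLE A N (Λ.degree + Λ.fermionicDegree) := by
  refine Submodule.sum_mem _ fun t ht => ?_
  refine tmul_mem_degLE (m := Λ.anti.length) ?_ (Nat.le_add_left _ _) (thetaProd_mem _)
  have hs : ∑ i, t.2 i = Λ.degree := by
    simp only [monIndex, mem_filter, mem_product, mem_piAntidiag] at ht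
    exact ht.1.2.1
  refine (MvPolynomial.totalDegree_finsetProd _ _).trans ?_
  calc _ ≤ ∑ i, t.2 i := Finset.sum_le_sum fun i _ => totalDegree_X_pow_le i (t.2 i)
    _ ≤ _ := by omega

end Mon

/-- The monomial symmetric function `m_Λ`. -/
def mono (A : Type*) [CommRing A] (Λ : Superpartition) : SymSuper A :=
  ⟨fun N => mPoly A Λ N, fun _ σ => permAct_mPoly Λ σ, fun N => restr_mPoly Λ N,
    _, fun _ => mPoly_mem_degLE Λ⟩

/-! ## Elementary symmetric functions -/

section Elem

variable (A : Type*) [CommRing A]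

/-- `e_n` in `N` pairs of variables. -/
def ePoly (n N : ℕ) : SuperPoly A N := MvPolynomial.esymm (Fin N) A n ⊗ₜ[A] 1

/-- `ẽ_n` in `N` pairs of variables, the sum of the `θ_i x_{j_1} ⋯ x_{j_n}` over all `i` and all
`n`-element sets `J = {j_1, …, j_n}` with `i ∉ J`. -/
def eTildePoly (n N : ℕ) : SuperPoly A N :=
  ∑ t ∈ (univ ×ˢ powersetCard n univ : Finset (Fin N × Finset (Fin N))) with t.1 ∉ t.2,
    (∏ j ∈ t.2, MvPolynomial.X j) ⊗ₜ[A] theta A t.1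

/-- `p_n` in `N` pairs of variables. -/
def pPoly (n N : ℕ) : SuperPoly A N :=
  (∑ i : Fin N, MvPolynomial.X i ^ n : MvPolynomial (Fin N) A) ⊗ₜ[A] 1

/-- `p̃_n` in `N` pairs of variables. -/
def pTildePoly (n N : ℕ) : SuperPoly A N :=
  ∑ i : Fin N, (MvPolynomial.X i ^ n) ⊗ₜ[A] theta A i

end Elem

section ElemFacts

variable {A : Type*} [CommRing A]

theorem tmul_one_mem_degLE {N d : ℕ} {p : MvPolynomial (Fin N) A} (hp : p.totalDegree ≤ d) :
    p ⊗ₜ[A] (1 : ExteriorAlgebra A (Fin N → A)) ∈ degLE A N d :=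
  tmul_mem_degLE (m := 0) hp (Nat.zero_le d)
    (by simp)

theorem totalDegree_prod_X_le {N : ℕ} (s : Finset (Fin N)) :
    (∏ j ∈ s, MvPolynomial.X j : MvPolynomial (Fin N) A).totalDegree ≤ s.card := by
  refine (MvPolynomial.totalDegree_finsetProd _ _).trans ?_
  refine (Finset.sum_le_card_nsmul _ _ 1 fun i _ => ?_).trans (by simp)
  simpa using totalDegree_X_pow_le (A := A) i 1

theorem castSucc_image {N : ℕ} {t : Finset (Fin (N + 1))} (h : Fin.last N ∉ t) :
    (univ.filter fun i => Fin.castSucc i ∈ t).map Fin.castSuccEmb = t := by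
  ext i
  induction i using Fin.lastCases with
  | last => simp [h, Fin.castSucc_ne_last]
  | cast i => simp

theorem ePoly_mem (n : ℕ) : (fun N => ePoly A n N) ∈ SymSuper A := by
  refine ⟨fun N σ => ?_, fun N => ?_, n, fun N => ?_⟩
  · simp only [ePoly]
    rw [permAct, Algebra.TensorProduct.map_tmul, map_one, MvPolynomial.rename_esymm]
  · simp only [ePoly]
    rw [restr, Algebra.TensorProduct.map_tmul, map_one]
    congr 1
    rw [MvPolynomial.esymm, MvPolynomial.esymm, map_sum]
    symm
    refine Finset.sum_of_injOn (fun s => s.map Fin.castSuccEmb)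
      (fun s _ t _ h => Finset.map_injective _ h) ?_ ?_ ?_
    · intro s hs
      simpa using hs
    · intro t ht hn
      have hl : Fin.last N ∈ t := by
        by_contra hl
        refine hn ⟨univ.filter fun i => Fin.castSucc i ∈ t, ?_, castSucc_image hl⟩
        have := congrArg Finset.card (castSucc_image hl)
        rw [card_map] at this
        simpa [this] using ht
      rw [map_prod, Finset.prod_eq_zero hl restr_X_last]
    · intro s _
      rw [map_prod, Finset.prod_map]
      exact Finset.prod_congr rfl fun i _ => (restr_X_castSucc i).symm
  · refine tmul_one_mem_degLE ?_
    rw [MvPolynomial.esymm]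
    refine MvPolynomial.totalDegree_finsetSum_le fun s hs => ?_
    exact (totalDegree_prod_X_le s).trans (by simpa using (mem_powersetCard.mp hs).2.le)

theorem eTildePoly_mem (n : ℕ) : (fun N => eTildePoly A n N) ∈ SymSuper A := by
  refine ⟨fun N σ => ?_, fun N => ?_, n + 1, fun N => ?_⟩
  · simp only [eTildePoly]
    rw [map_sum]
    refine Finset.sum_equiv (σ.prodCongr σ.finsetCongr) (fun t => ?_) (fun t _ => ?_)
    · simp
    · rw [permAct, Algebra.TensorProduct.map_tmul, map_perm_theta, map_prod]
      simp [Finset.prod_map]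
  · simp only [eTildePoly]
    rw [map_sum]
    symm
    refine Finset.sum_of_injOn (fun s => (s.1.castSucc, s.2.map Fin.castSuccEmb))
      ?_ ?_ ?_ ?_
    · rintro ⟨i, s⟩ _ ⟨j, t⟩ _ h
      simpa using h
    · rintro ⟨i, s⟩ hs
      simpa using hs
    · rintro ⟨i, t⟩ ht hn
      rw [restr, Algebra.TensorProduct.map_tmul]
      by_cases hl : Fin.last N ∈ t
      · rw [map_prod, Finset.prod_eq_zero hl restr_X_last, TensorProduct.zero_tmul]
      induction i using Fin.lastCases with
      | last => rw [map_castSucc_theta_last, TensorProduct.tmul_zero]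
      | cast i =>
        refine absurd ⟨(i, univ.filter fun i => Fin.castSucc i ∈ t), ?_,
          Prod.ext rfl (castSucc_image hl)⟩ hn
        have := congrArg Finset.card (castSucc_image hl)
        rw [card_map] at this
        simpa [this] using ht
    · rintro ⟨i, s⟩ _
      rw [restr, Algebra.TensorProduct.map_tmul, map_castSucc_theta, map_prod, Finset.prod_map]
      congr 1
      exact Finset.prod_congr rfl fun i _ => (restr_X_castSucc i).symm
  · refine Submodule.sum_mem _ fun t ht => ?_
    refine tmul_mem_degLE ((totalDegree_prod_X_le _).trans ?_) (Nat.le_add_left 1 n) (theta_mem _)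
    have := (mem_powersetCard.mp (mem_product.mp (mem_filter.mp ht).1).2).2
    omega

theorem pPoly_mem (n : ℕ) (hn : n ≠ 0) : (fun N => pPoly A n N) ∈ SymSuper A := by
  refine ⟨fun N σ => ?_, fun N => ?_, n, fun N => ?_⟩
  · simp only [pPoly]
    rw [permAct, Algebra.TensorProduct.map_tmul, map_one, map_sum]
    simp only [map_pow, MvPolynomial.rename_X]
    rw [Equiv.sum_comp σ (fun i => (MvPolynomial.X i : MvPolynomial (Fin N) A) ^ n)]
  · simp only [pPoly]
    rw [restr, Algebra.TensorProduct.map_tmul, map_one, map_sum, Fin.sum_univ_castSucc]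
    simp only [map_pow, restr_X_castSucc, restr_X_last, zero_pow hn, add_zero]
  · refine tmul_one_mem_degLE (MvPolynomial.totalDegree_finsetSum_le fun i _ => ?_)
    exact totalDegree_X_pow_le i n

theorem pTildePoly_mem (n : ℕ) : (fun N => pTildePoly A n N) ∈ SymSuper A := by
  refine ⟨fun N σ => ?_, fun N => ?_, n + 1, fun N => ?_⟩
  · simp only [pTildePoly]
    rw [map_sum]
    refine Finset.sum_equiv σ (by simp) fun i _ => ?_
    rw [permAct, Algebra.TensorProduct.map_tmul, map_perm_theta, map_pow, MvPolynomial.rename_X]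
  · simp only [pTildePoly]
    rw [map_sum, Fin.sum_univ_castSucc]
    simp only [restr, Algebra.TensorProduct.map_tmul, map_castSucc_theta, map_castSucc_theta_last,
      TensorProduct.tmul_zero, add_zero, map_pow, restr_X_castSucc]
  · refine Submodule.sum_mem _ fun i _ => ?_
    exact tmul_mem_degLE ((totalDegree_X_pow_le i n).trans (Nat.le_succ n))
      (Nat.le_add_left 1 n) (theta_mem i)

end ElemFacts

/-! ## The bases and the homomorphism -/

section Bases

variable (A : Type*) [CommRing A]

/-- The bosonic elementary symmetric function `e_n`, with `e_0 = 1`. -/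
def elem (n : ℕ) : SymSuper A := ⟨fun N => ePoly A n N, ePoly_mem n⟩

/-- The fermionic elementary symmetric function `ẽ_n`, with `ẽ_0 = ∑ θ_i`. -/
def elemTilde (n : ℕ) : SymSuper A := ⟨fun N => eTildePoly A n N, eTildePoly_mem n⟩

/-- The bosonic complete symmetric function `h_n = ∑_{λ ⊢ n} m_λ`. -/
def complete (n : ℕ) : SymSuper A := ∑ μ : n.Partition, mono A (bosonic μ)

/-- The fermionic complete symmetric function `h̃_n = ∑_{Λ ⊢ (n|1)} (Λ_1 + 1) m_Λ`; the
superpartitions of `(n|1)` are the `(k; μ)` with `0 ≤ k ≤ n` and `μ ⊢ n - k`. -/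
def completeTilde (n : ℕ) : SymSuper A :=
  ∑ k ∈ range (n + 1), ∑ μ : (n - k).Partition, (k + 1) • mono A (oneFermion k μ)

/-- The bosonic power sum `p_n = ∑ x_i ^ n` for `n ≥ 1`, and `p_0 = 0`. -/
def power (n : ℕ) : SymSuper A :=
  if hn : n = 0 then 0 else ⟨fun N => pPoly A n N, pPoly_mem n hn⟩

/-- The fermionic power sum `p̃_n = ∑ θ_i x_i ^ n`. -/
def powerTilde (n : ℕ) : SymSuper A := ⟨fun N => pTildePoly A n N, pTildePoly_mem n⟩

/-- The product `p_Λ = p̃_{Λ_1} ⋯ p̃_{Λ_m} p_{Λ_{m+1}} ⋯ p_{Λ_ℓ}`, in this order. -/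
def powerProd (Λ : Superpartition) : SymSuper A :=
  (Λ.anti.map (powerTilde A)).prod * (Λ.sym.map (power A)).prod

end Bases

/-- The defining relations of the homomorphism `ω̂`: it sends `e_n` to `h_n` and `ẽ_n` to `h̃_n`. -/
def IsOmegaHat (ω : SymSuper ℤ →+* SymSuper ℤ) : Prop :=
  (∀ n, ω (elem ℤ n) = complete ℤ n) ∧ ∀ n, ω (elemTilde ℤ n) = completeTilde ℤ n

end SuperSym

end

noncomputable section

namespace SuperSym

/-! ## The top coefficient in a Grassmann algebra -/

/-! The core is a structure theorem: symmetric superfunctions are the free supercommutative algebra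
on even generators e_1, e_2, … and odd generators p̃_0, p̃_1, … (`elemEquiv`). Granting it, ω̂ may
be defined by e_n ↦ h_n and p̃_n ↦ (-1)^n p̃_n. The identities ẽ_n = ∑ (-1)^k p̃_k e_{n-k} and h̃_n
= ∑ p̃_k h_{n-k} (`elemTilde_eq_sum`, `completeTilde_eq_sum`) then give ẽ_n ↦ h̃_n. Both are
triangular in the p̃_k with diagonal coefficients ±1. Hence any homomorphism with the prescribed
values on e_n and ẽ_n has the stated values on p̃_n, which gives uniqueness; comparing Newton's
identities for e_n and h_n gives the values on p_n in the same way. No division is needed, so all of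
this works over ℤ.

For the structure theorem, write p̃_K for the ordered product of the p̃_k, k ∈ K. In N pairs of
variables, p̃_0, …, p̃_{N-1} are linear forms in the θ_i whose matrix (x_i^k) has the Vandermonde
determinant V. A Grassmann version of Cramer's rule (`det_smul_eq_sum_topForm`) expands V f in the
p̃_K; up to sign, the coefficient of p̃_K is the θ_1⋯θ_N-coefficient of p̃_{Kᶜ} f. If f is
invariant, this coefficient is alternating, hence divisible by V. Thus f = ∑ c_K p̃_K with unique,
symmetric c_K (`exists_symmetric_expansion`), and deg c_K + ∑_{k ∈ K} k is at most the x-degree of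
f.

The degree bound makes the passage to infinitely many variables possible. An invariant of x-degree
at most d in N + 1 > d + 1 pairs of variables is determined by its restriction to N pairs
(`eq_zero_of_restr_eq_zero`), so an identity of bounded degree d can be checked in d + 1 pairs of
variables. There, surjectivity follows from the expansion above and the fundamental theorem on
symmetric polynomials. Injectivity follows by specializing to sufficiently many variables. -/

/-- The product of the `w i`, `i ∈ K`, in increasing order of the index. -/
def sortProd {I B : Type*} [LinearOrder I] [Monoid B] (w : I → B) (K : Finset I) : B :=
  (K.sort.map w).prod

theorem map_sortProd {I B C F : Type*} [LinearOrder I] [Monoid B] [Monoid C] [FunLike F B C]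
    [MonoidHomClass F B C] (φ : F) (w : I → B) (K : Finset I) :
    φ (sortProd w K) = sortProd (fun i => φ (w i)) K := by
  simp only [sortProd, map_list_prod, List.map_map, Function.comp_def]

section Top

variable {R : Type*} [CommRing R] {N : ℕ}

theorem listProd_ι_eq_ιMulti {I M : Type*} [AddCommGroup M] [Module R M] (v : I → M)
    (l : List I) : (l.map fun i => ExteriorAlgebra.ι R (v i)).prod =
      ExteriorAlgebra.ιMulti R l.length fun k => v (l.get k) := by
  rw [ExteriorAlgebra.ιMulti_apply]
  congr 1
  apply List.ext_getElem <;> simp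

theorem listProd_theta_eq_ιMulti (l : List (Fin N)) : (l.map (theta R)).prod =
    ExteriorAlgebra.ιMulti R l.length fun k => Pi.single (l.get k) 1 :=
  listProd_ι_eq_ιMulti (fun i => Pi.single i 1) l

theorem sortProd_ι_mul_sortProd_ι_of_not_disjoint {I M : Type*} [LinearOrder I] [AddCommGroup M]
    [Module R M] (v : I → M) {K L : Finset I} (h : ¬ Disjoint K L) :
    sortProd (fun i => ExteriorAlgebra.ι R (v i)) K *
      sortProd (fun i => ExteriorAlgebra.ι R (v i)) L = 0 := by
  rw [sortProd, sortProd, ← List.prod_append, ← List.map_append, listProd_ι_eq_ιMulti]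
  refine ExteriorAlgebra.ιMulti_eq_zero_of_not_inj fun hi => h ?_
  have hn : (K.sort ++ L.sort).Nodup := by
    rw [List.nodup_iff_injective_get]
    exact fun a b hab => hi (congrArg v hab)
  rw [Finset.disjoint_left]
  intro a ha hb
  exact (List.disjoint_of_nodup_append hn) (by simpa using ha) (by simpa using hb)

theorem basis_exteriorAlgebra_eq_sortProd {I M : Type*} [LinearOrder I] [AddCommGroup M]
    [Module R M] (b : Module.Basis I R M) (K : Finset I) :
    b.ExteriorAlgebra K = sortProd (fun i => ExteriorAlgebra.ι R (b i)) K := by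
  rw [ExteriorAlgebra.basis_apply, sortProd]
  refine (ExteriorAlgebra.ιMulti_apply _).trans ?_
  congr 1
  apply List.ext_getElem
  · simp
  · intro i h1 h2
    simp
    rfl

/-- The coefficient of `θ_1 ⋯ θ_N`. -/
def topForm (R : Type*) [CommRing R] (N : ℕ) : ExteriorAlgebra R (Fin N → R) →ₗ[R] R :=
  ExteriorAlgebra.liftAlternating fun m =>
    if h : m = N then (Matrix.detRowAlternating (R := R) (n := Fin N)).domDomCongr
      (finCongr h.symm) else 0

theorem topForm_ιMulti (v : Fin N → Fin N → R) :
    topForm R N (ExteriorAlgebra.ιMulti R N v) = (Matrix.of v).det := by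
  rw [topForm, ExteriorAlgebra.liftAlternating_apply_ιMulti, dif_pos rfl]
  rfl

theorem topForm_ιMulti_of_eq {m : ℕ} (h : m = N) (v : Fin m → Fin N → R) :
    topForm R N (ExteriorAlgebra.ιMulti R m v) =
      (Matrix.of fun k => v (Fin.cast h.symm k)).det := by
  subst h
  exact topForm_ιMulti v

theorem topForm_ιMulti_of_ne {m : ℕ} (h : m ≠ N) (v : Fin m → Fin N → R) :
    topForm R N (ExteriorAlgebra.ιMulti R m v) = 0 := by
  rw [topForm, ExteriorAlgebra.liftAlternating_apply_ιMulti, dif_neg h]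
  rfl

/-- Multiplicativity of the determinant in degree N; in every other degree both sides vanish. -/
theorem topForm_map_vecMulLinear (M : Matrix (Fin N) (Fin N) R)
    (f : ExteriorAlgebra R (Fin N → R)) :
    topForm R N (ExteriorAlgebra.map M.vecMulLinear f) = M.det * topForm R N f := by
  suffices (topForm R N).comp (ExteriorAlgebra.map M.vecMulLinear).toLinearMap =
      M.det • topForm R N from LinearMap.congr_fun this f
  refine ExteriorAlgebra.lhom_ext fun m => AlternatingMap.ext fun v => ?_
  simp only [LinearMap.compAlternatingMap_apply, LinearMap.comp_apply, AlgHom.toLinearMap_apply,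
    LinearMap.smul_apply, ExteriorAlgebra.map_apply_ιMulti]
  by_cases h : m = N
  · subst h
    rw [topForm_ιMulti, topForm_ιMulti, smul_eq_mul, mul_comm, ← Matrix.det_mul]
    rfl
  · rw [topForm_ιMulti_of_ne h, topForm_ιMulti_of_ne h, smul_zero]

theorem topForm_listProd_of_length_ne {l : List (Fin N)} (h : l.length ≠ N)
    (v : Fin N → Fin N → R) :
    topForm R N (l.map fun i => ExteriorAlgebra.ι R (v i)).prod = 0 := by
  rw [listProd_ι_eq_ιMulti, topForm_ιMulti_of_ne h]

/-- The list enumerates all indices once, so the top coefficient is the determinant of a permutation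
matrix, that is ±1. -/
theorem topForm_theta_mul_self {l : List (Fin N)} (h : l.length = N) (hn : l.Nodup) :
    topForm R N (l.map (theta R)).prod * topForm R N (l.map (theta R)).prod = 1 := by
  have h1 : (l.map (theta R)).prod = ExteriorAlgebra.ιMulti R N
      fun k => Pi.single (l.get (Fin.cast h.symm k)) 1 := by
    rw [ExteriorAlgebra.ιMulti_apply]
    congr 1
    apply List.ext_getElem <;> simp [h, theta]
  have hi : Function.Injective fun k : Fin N => l.get (Fin.cast h.symm k) :=
    (List.nodup_iff_injective_get.mp hn).comp (Fin.cast_injective _)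
  let σ : Equiv.Perm (Fin N) := Equiv.ofBijective _ (Finite.injective_iff_bijective.mp hi)
  have h2 : (Matrix.of fun k => (Pi.single (l.get (Fin.cast h.symm k)) 1 : Fin N → R)) =
      (1 : Matrix (Fin N) (Fin N) R).submatrix σ id := by
    ext i j
    simp [Matrix.one_apply, Pi.single_apply, σ, eq_comm]
  rw [h1, topForm_ιMulti, h2, Matrix.det_permute, Matrix.det_one, mul_one]
  rcases Int.units_eq_one_or (Equiv.Perm.sign σ) with h | h <;> simp [h]

/-- The sign of the shuffle that sorts the complement of `K` followed by `K`. -/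
def complSign (R : Type*) [CommRing R] {N : ℕ} (K : Finset (Fin N)) : R :=
  topForm R N (sortProd (theta R) Kᶜ * sortProd (theta R) K)

theorem complSign_mul_self (K : Finset (Fin N)) : complSign R K * complSign R K = 1 := by
  rw [complSign, sortProd, sortProd, ← List.prod_append, ← List.map_append]
  refine topForm_theta_mul_self ?_ ?_
  · simp [Finset.card_compl]
    have := K.card_le_univ
    simp at this
    omega
  · refine List.Nodup.append (by simp) (by simp) ?_
    intro a
    simp

/-- Either some factor occurs twice, or L is a proper subset of K and there are fewer than N
factors. -/
theorem topForm_sortProd_compl_mul_sortProd (v : Fin N → Fin N → R) {K L : Finset (Fin N)}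
    (h : K ≠ L) : topForm R N (sortProd (fun i => ExteriorAlgebra.ι R (v i)) Kᶜ *
      sortProd (fun i => ExteriorAlgebra.ι R (v i)) L) = 0 := by
  by_cases hd : Disjoint Kᶜ L
  · rw [sortProd, sortProd, ← List.prod_append, ← List.map_append]
    refine topForm_listProd_of_length_ne ?_ v
    have hs : L ⊆ K := fun x hx => by
      by_contra hK
      exact Finset.disjoint_left.mp hd (by simpa using hK) hx
    have hlt := Finset.card_lt_card (hs.ssubset_of_ne h.symm)
    have := K.card_le_univ
    simp [Finset.card_compl] at this ⊢
    omega
  · rw [sortProd_ι_mul_sortProd_ι_of_not_disjoint v hd, map_zero]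

/-- The monomials in the θ_i form a basis, and multiplication by the complementary monomial followed
by the top coefficient is the dual basis up to sign. -/
theorem eq_sum_topForm (f : ExteriorAlgebra R (Fin N → R)) :
    f = ∑ K : Finset (Fin N), (complSign R K * topForm R N (sortProd (theta R) Kᶜ * f)) •
      sortProd (theta R) K := by
  let b := Pi.basisFun R (Fin N)
  let g : ExteriorAlgebra R (Fin N → R) →ₗ[R] ExteriorAlgebra R (Fin N → R) :=
    ∑ K : Finset (Fin N), (complSign R K •
      (topForm R N).comp (LinearMap.mulLeft R (sortProd (theta R) Kᶜ))).smulRight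
        (sortProd (theta R) K)
  suffices LinearMap.id = g by
    have := LinearMap.congr_fun this f
    simpa [g, LinearMap.sum_apply] using this
  refine b.ExteriorAlgebra.ext fun L => ?_
  have hL : b.ExteriorAlgebra L = sortProd (theta R) L := by
    rw [basis_exteriorAlgebra_eq_sortProd]
    congr 1
    ext i
    simp [b, theta]
  rw [hL]
  simp only [g, LinearMap.sum_apply, LinearMap.smulRight_apply, LinearMap.smul_apply,
    LinearMap.comp_apply, LinearMap.mulLeft_apply, LinearMap.id_apply, smul_eq_mul]
  rw [Finset.sum_eq_single L]
  · change _ = (complSign R L * complSign R L) • _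
    rw [complSign_mul_self, one_smul]
  · intro K _ hK
    have := topForm_sortProd_compl_mul_sortProd (R := R) (fun i => Pi.single i 1) hK
    change topForm R N (sortProd (theta R) Kᶜ * sortProd (theta R) L) = 0 at this
    rw [this, mul_zero, zero_smul]
  · simp

/-- On a linear form the adjugate gives a preimage after one multiplication by the determinant;
products and sums only raise the exponent. -/
theorem exists_det_pow_smul_mem_range (M : Matrix (Fin N) (Fin N) R)
    (f : ExteriorAlgebra R (Fin N → R)) :
    ∃ (n : ℕ) (g : ExteriorAlgebra R (Fin N → R)),
      M.det ^ n • f = ExteriorAlgebra.map M.vecMulLinear g := by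
  induction f using ExteriorAlgebra.induction with
  | algebraMap r => exact ⟨0, algebraMap _ _ r, by simp⟩
  | ι x =>
    refine ⟨1, ExteriorAlgebra.ι R (Matrix.vecMul x M.adjugate), ?_⟩
    rw [ExteriorAlgebra.map_apply_ι, Matrix.vecMulLinear_apply, Matrix.vecMul_vecMul,
      Matrix.adjugate_mul, Matrix.vecMul_smul, Matrix.vecMul_one, map_smul, pow_one]
  | mul a b ha hb =>
    obtain ⟨n, g, hg⟩ := ha
    obtain ⟨m, k, hk⟩ := hb
    exact ⟨n + m, g * k, by rw [map_mul, ← hg, ← hk, smul_mul_smul_comm, pow_add]⟩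
  | add a b ha hb =>
    obtain ⟨n, g, hg⟩ := ha
    obtain ⟨m, k, hk⟩ := hb
    refine ⟨n + m, M.det ^ m • g + M.det ^ n • k, ?_⟩
    rw [map_add, map_smul, map_smul, ← hg, ← hk, smul_smul, smul_smul, ← pow_add, ← pow_add,
      add_comm m, smul_add]

/-- Cramer's rule in a Grassmann algebra. -/
theorem det_smul_eq_sum_topForm [IsDomain R] (M : Matrix (Fin N) (Fin N) R) (hM : M.det ≠ 0)
    (f : ExteriorAlgebra R (Fin N → R)) :
    M.det • f = ∑ K : Finset (Fin N), (complSign R K *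
      topForm R N (sortProd (fun i => ExteriorAlgebra.ι R (M i)) Kᶜ * f)) •
      sortProd (fun i => ExteriorAlgebra.ι R (M i)) K := by
  obtain ⟨n, g, hg⟩ := exists_det_pow_smul_mem_range M f
  have hw : ∀ K : Finset (Fin N), sortProd (fun i => ExteriorAlgebra.ι R (M i)) K =
      ExteriorAlgebra.map M.vecMulLinear (sortProd (theta R) K) := by
    intro K
    rw [map_sortProd]
    congr 1
    ext i
    rw [theta, ExteriorAlgebra.map_apply_ι, Matrix.vecMulLinear_apply, Matrix.single_one_vecMul]
    rfl
  have hfree : Module.Free R (ExteriorAlgebra R (Fin N → R)) :=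
    Module.Free.of_basis (Pi.basisFun R (Fin N)).ExteriorAlgebra
  -- After multiplication by `M.det ^ n`, f is the image of some g under the substitution of the
  -- rows of M for the θ_i. The formula is then the image of `eq_sum_topForm g`, and the power of
  -- the determinant cancels because the Grassmann algebra is free over a domain.
  have : M.det ^ n • (M.det • f) = M.det ^ n • ∑ K : Finset (Fin N), (complSign R K *
      topForm R N (sortProd (fun i => ExteriorAlgebra.ι R (M i)) Kᶜ * f)) •
      sortProd (fun i => ExteriorAlgebra.ι R (M i)) K := by
    rw [smul_comm, hg, Finset.smul_sum]
    nth_rewrite 1 [eq_sum_topForm g]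
    rw [map_sum, Finset.smul_sum]
    refine Finset.sum_congr rfl fun K _ => ?_
    rw [map_smul, ← hw K, smul_smul, smul_smul]
    congr 1
    have h1 : M.det ^ n * topForm R N (sortProd (fun i => ExteriorAlgebra.ι R (M i)) Kᶜ * f) =
        M.det * topForm R N (sortProd (theta R) Kᶜ * g) := by
      rw [← topForm_map_vecMulLinear, map_mul (ExteriorAlgebra.map M.vecMulLinear), ← hw, ← hg, mul_smul_comm, map_smul, smul_eq_mul]
    linear_combination -complSign R K * h1
  exact smul_right_injective _ (pow_ne_zero n hM) this

end Top

/-! ## The top coefficient of a superpolynomial -/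

/-- The squares need their own hypothesis, since anticommutation only gives that twice the square is
zero. -/
theorem sum_mul_self_eq_zero {I B : Type*} [Ring B] (s : Finset I) (f : I → B)
    (h0 : ∀ i, f i * f i = 0) (h : ∀ i j, f i * f j + f j * f i = 0) :
    (∑ i ∈ s, f i) * ∑ i ∈ s, f i = 0 := by
  classical
  induction s using Finset.induction_on with
  | empty => simp
  | insert a s ha ih =>
    have h1 : f a * ∑ i ∈ s, f i + (∑ i ∈ s, f i) * f a = 0 := by
      rw [Finset.mul_sum, Finset.sum_mul, ← Finset.sum_add_distrib]
      exact Finset.sum_eq_zero fun i _ => h a i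
    rw [Finset.sum_insert ha, add_mul, mul_add, mul_add, h0, ih, zero_add, add_zero, h1]

section Super

variable {A : Type*} [CommRing A] {N : ℕ}

theorem theta_mul_self (i : Fin N) : theta A i * theta A i = 0 :=
  ExteriorAlgebra.ι_sq_zero _

theorem theta_mul_add_theta_mul (i j : Fin N) :
    theta A i * theta A j + theta A j * theta A i = 0 :=
  ExteriorAlgebra.ι_add_mul_swap _ _

/-- The linear form `∑ v_i θ_i` in the Grassmann variables. -/
def thetaForm (A : Type*) [CommRing A] (N : ℕ) :
    (Fin N → MvPolynomial (Fin N) A) →ₗ[MvPolynomial (Fin N) A] SuperPoly A N where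
  toFun v := ∑ i, v i ⊗ₜ[A] theta A i
  map_add' v w := by simp [TensorProduct.add_tmul, Finset.sum_add_distrib]
  map_smul' p v := by simp [Finset.smul_sum, TensorProduct.smul_tmul']

theorem thetaForm_mul_self (v : Fin N → MvPolynomial (Fin N) A) :
    thetaForm A N v * thetaForm A N v = 0 := by
  refine sum_mul_self_eq_zero (B := SuperPoly A N) univ (fun i => v i ⊗ₜ[A] theta A i)
    (fun i => ?_) fun i j => ?_
  · rw [Algebra.TensorProduct.tmul_mul_tmul, theta_mul_self, TensorProduct.tmul_zero]
  · rw [Algebra.TensorProduct.tmul_mul_tmul, Algebra.TensorProduct.tmul_mul_tmul,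
      mul_comm (v j), ← TensorProduct.tmul_add, theta_mul_add_theta_mul, TensorProduct.tmul_zero]

/-- The Grassmann algebra over the polynomial ring maps to the superpolynomials. -/
def ofGrassmann (A : Type*) [CommRing A] (N : ℕ) :
    ExteriorAlgebra (MvPolynomial (Fin N) A) (Fin N → MvPolynomial (Fin N) A)
      →ₐ[MvPolynomial (Fin N) A] SuperPoly A N :=
  ExteriorAlgebra.lift _ ⟨thetaForm A N, thetaForm_mul_self⟩

theorem ofGrassmann_ι (v : Fin N → MvPolynomial (Fin N) A) :
    ofGrassmann A N (ExteriorAlgebra.ι _ v) = ∑ i, v i ⊗ₜ[A] theta A i :=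
  ExteriorAlgebra.lift_ι_apply _ _ _ _

theorem ι_eq_sum_theta (x : Fin N → A) :
    ExteriorAlgebra.ι A x = ∑ i, x i • theta A i := by
  nth_rewrite 1 [← Finset.univ_sum_single x]
  rw [map_sum]
  refine Finset.sum_congr rfl fun i _ => ?_
  rw [theta, ← map_smul, ← Pi.single_smul, smul_eq_mul, mul_one]

theorem ofGrassmann_surjective : Function.Surjective (ofGrassmann A N) := by
  have h : ∀ u : ExteriorAlgebra A (Fin N → A), 1 ⊗ₜ[A] u ∈ (ofGrassmann A N).range := by
    intro u
    induction u using ExteriorAlgebra.induction with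
    | algebraMap r =>
      refine ⟨algebraMap (MvPolynomial (Fin N) A) _ (MvPolynomial.C r), ?_⟩
      change ofGrassmann A N _ = _
      rw [AlgHom.commutes, Algebra.TensorProduct.algebraMap_apply,
        Algebra.algebraMap_eq_smul_one r, ← TensorProduct.smul_tmul]
      congr 1
      simp [Algebra.smul_def]
    | ι x =>
      refine ⟨ExteriorAlgebra.ι _ fun i => MvPolynomial.C (x i), ?_⟩
      change ofGrassmann A N _ = _
      rw [ofGrassmann_ι, ι_eq_sum_theta, TensorProduct.tmul_sum]
      refine Finset.sum_congr rfl fun i _ => ?_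
      rw [← TensorProduct.smul_tmul]
      congr 1
      simp [Algebra.smul_def]
    | mul a b ha hb =>
      have := mul_mem ha hb
      rwa [Algebra.TensorProduct.tmul_mul_tmul, one_mul] at this
    | add a b ha hb =>
      rw [TensorProduct.tmul_add]
      exact add_mem ha hb
  intro f
  change f ∈ (ofGrassmann A N).range
  induction f using TensorProduct.induction_on with
  | zero => exact zero_mem _
  | tmul p u =>
    have := Subalgebra.smul_mem _ (h u) p
    rwa [TensorProduct.smul_tmul', smul_eq_mul, mul_one] at this
  | add f g hf hg => exact add_mem hf hg

/-- The coefficient of `θ_1 ⋯ θ_N` in a superpolynomial. -/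
def topCoeff (A : Type*) [CommRing A] (N : ℕ) :
    SuperPoly A N →ₗ[MvPolynomial (Fin N) A] MvPolynomial (Fin N) A :=
  (Algebra.TensorProduct.rid A (MvPolynomial (Fin N) A)
    (MvPolynomial (Fin N) A)).toLinearMap ∘ₗ
    (topForm A N).baseChange (MvPolynomial (Fin N) A)

theorem topCoeff_tmul (p : MvPolynomial (Fin N) A) (u : ExteriorAlgebra A (Fin N → A)) :
    topCoeff A N (p ⊗ₜ[A] u) = topForm A N u • p := by
  simp [topCoeff]

theorem ofGrassmann_listProd_theta (l : List (Fin N)) :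
    ofGrassmann A N (l.map (theta (MvPolynomial (Fin N) A))).prod =
      1 ⊗ₜ[A] (l.map (theta A)).prod := by
  have h : ∀ i : Fin N, ofGrassmann A N (theta (MvPolynomial (Fin N) A) i) =
      1 ⊗ₜ[A] theta A i := by
    intro i
    rw [theta, ofGrassmann_ι, Finset.sum_eq_single i]
    · simp
    · intro j _ hj
      simp [hj]
    · simp
  induction l with
  | nil => simp [Algebra.TensorProduct.one_def]
  | cons a l ih =>
    rw [List.map_cons, List.prod_cons, map_mul, ih, h, Algebra.TensorProduct.tmul_mul_tmul]
    simp

/-- This carries the determinant calculus over the polynomial ring to superpolynomials, where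
Cramer's rule will be applied. -/
theorem topCoeff_ofGrassmann
    (f : ExteriorAlgebra (MvPolynomial (Fin N) A) (Fin N → MvPolynomial (Fin N) A)) :
    topCoeff A N (ofGrassmann A N f) = topForm (MvPolynomial (Fin N) A) N f := by
  suffices topCoeff A N ∘ₗ (ofGrassmann A N).toLinearMap = topForm _ N from
    LinearMap.congr_fun this f
  refine (Pi.basisFun (MvPolynomial (Fin N) A) (Fin N)).ExteriorAlgebra.ext fun K => ?_
  have hK : (Pi.basisFun (MvPolynomial (Fin N) A) (Fin N)).ExteriorAlgebra K =
      (K.sort.map (theta (MvPolynomial (Fin N) A))).prod := by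
    rw [basis_exteriorAlgebra_eq_sortProd, sortProd]
    congr 2
    ext1 i
    simp [theta]
  rw [hK]
  simp only [LinearMap.comp_apply, AlgHom.toLinearMap_apply]
  rw [ofGrassmann_listProd_theta, topCoeff_tmul]
  rw [listProd_theta_eq_ιMulti, listProd_theta_eq_ιMulti]
  by_cases h : K.sort.length = N
  · rw [topForm_ιMulti_of_eq h, topForm_ιMulti_of_eq h, MvPolynomial.smul_eq_C_mul, mul_one, RingHom.map_det]
    refine congrArg Matrix.det (Matrix.ext fun i j => ?_)
    simp only [Matrix.of_apply, RingHom.mapMatrix_apply, Matrix.map_apply, Pi.single_apply]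
    split_ifs <;> simp
  · rw [topForm_ιMulti_of_ne h, topForm_ιMulti_of_ne h, zero_smul]

theorem topForm_map_perm (σ : Equiv.Perm (Fin N)) (u : ExteriorAlgebra A (Fin N → A)) :
    topForm A N (ExteriorAlgebra.map (LinearMap.funLeft A A σ.symm) u) =
      (Equiv.Perm.sign σ : ℤ) * topForm A N u := by
  have h : LinearMap.funLeft A A σ.symm =
      ((1 : Matrix (Fin N) (Fin N) A).submatrix σ id).vecMulLinear := by
    ext i j
    have : (j = σ i) ↔ i = σ.symm j := by rw [Equiv.eq_symm_apply, eq_comm]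
    simp [LinearMap.funLeft_apply, Matrix.one_apply, Pi.single_apply, eq_comm, this]
  rw [h, topForm_map_vecMulLinear, Matrix.det_permute, Matrix.det_one, mul_one]

/-- Permuting the θ_i multiplies θ_1⋯θ_N by the sign. Consequently the top coefficient of an
invariant superpolynomial is alternating. -/
theorem topCoeff_permAct (σ : Equiv.Perm (Fin N)) (f : SuperPoly A N) :
    topCoeff A N (permAct A σ f) =
      (Equiv.Perm.sign σ : ℤ) * MvPolynomial.rename σ (topCoeff A N f) := by
  induction f using TensorProduct.induction_on with
  | zero => simp
  | tmul p u =>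
    rw [permAct, Algebra.TensorProduct.map_tmul, topCoeff_tmul, topCoeff_tmul, map_smul]
    have := topForm_map_perm σ u
    change topForm A N (ExteriorAlgebra.map (LinearMap.funLeft A A σ.symm) u) • _ = _
    rw [this, MvPolynomial.smul_eq_C_mul, MvPolynomial.smul_eq_C_mul, map_mul, mul_assoc]
    simp
  | add f g hf hg => simp only [map_add, hf, hg, mul_add]

/-! ## Expansion in products of the fermionic power sums -/

theorem pTildePoly_eq_ofGrassmann (k : ℕ) :
    pTildePoly A k N = ofGrassmann A N (ExteriorAlgebra.ι _ fun i => MvPolynomial.X i ^ k) := by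
  rw [ofGrassmann_ι, pTildePoly]

/-- The matrix `(x_i ^ k)`, with rows indexed by `k`. -/
abbrev powMatrix (A : Type*) [CommRing A] (N : ℕ) :
    Matrix (Fin N) (Fin N) (MvPolynomial (Fin N) A) :=
  (Matrix.vandermonde MvPolynomial.X).transpose

theorem det_powMatrix : (powMatrix A N).det = (Matrix.vandermonde MvPolynomial.X).det :=
  Matrix.det_transpose _

theorem sortProd_pTildePoly_eq_ofGrassmann (K : Finset (Fin N)) :
    sortProd (fun k : Fin N => pTildePoly A k N) K =
      ofGrassmann A N (sortProd (fun k => ExteriorAlgebra.ι _ (powMatrix A N k)) K) := by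
  rw [map_sortProd]
  congr 1
  ext1 k
  rw [pTildePoly_eq_ofGrassmann]
  rfl

theorem det_vandermonde_X_ne_zero [IsDomain A] :
    (Matrix.vandermonde (MvPolynomial.X : Fin N → MvPolynomial (Fin N) A)).det ≠ 0 :=
  Matrix.det_vandermonde_ne_zero_iff.mpr (MvPolynomial.X_injective)

theorem vandermonde_smul_eq_sum [IsDomain A] (f : SuperPoly A N) :
    (Matrix.vandermonde (MvPolynomial.X : Fin N → MvPolynomial (Fin N) A)).det • f =
      ∑ K : Finset (Fin N), (complSign (MvPolynomial (Fin N) A) K *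
        topCoeff A N (sortProd (fun k : Fin N => pTildePoly A k N) Kᶜ * f)) •
          sortProd (fun k : Fin N => pTildePoly A k N) K := by
  obtain ⟨g, rfl⟩ := ofGrassmann_surjective f
  have h := congrArg (ofGrassmann A N) (det_smul_eq_sum_topForm (powMatrix A N)
    (by rw [det_powMatrix]; exact det_vandermonde_X_ne_zero) g)
  rw [map_smul, det_powMatrix, map_sum] at h
  rw [h]
  refine Finset.sum_congr rfl fun K _ => ?_
  rw [map_smul, sortProd_pTildePoly_eq_ofGrassmann, sortProd_pTildePoly_eq_ofGrassmann, ← map_mul,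
    topCoeff_ofGrassmann]

theorem topCoeff_sortProd_compl_mul_sortProd {K L : Finset (Fin N)} (h : K ≠ L) :
    topCoeff A N (sortProd (fun k : Fin N => pTildePoly A k N) Kᶜ *
      sortProd (fun k : Fin N => pTildePoly A k N) L) = 0 := by
  rw [sortProd_pTildePoly_eq_ofGrassmann, sortProd_pTildePoly_eq_ofGrassmann, ← map_mul,
    topCoeff_ofGrassmann]
  exact topForm_sortProd_compl_mul_sortProd _ h

theorem topCoeff_sortProd_compl_mul_self (K : Finset (Fin N)) :
    topCoeff A N (sortProd (fun k : Fin N => pTildePoly A k N) Kᶜ *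
      sortProd (fun k : Fin N => pTildePoly A k N) K) =
      (Matrix.vandermonde (MvPolynomial.X : Fin N → MvPolynomial (Fin N) A)).det *
        complSign (MvPolynomial (Fin N) A) K := by
  have hw : ∀ K : Finset (Fin N), sortProd (fun i => ExteriorAlgebra.ι _ (powMatrix A N i)) K =
      ExteriorAlgebra.map (powMatrix A N).vecMulLinear (sortProd (theta _) K) := by
    intro K
    rw [map_sortProd]
    congr 1
    ext1 i
    rw [theta, ExteriorAlgebra.map_apply_ι, Matrix.vecMulLinear_apply, Matrix.single_one_vecMul]
    rfl
  rw [sortProd_pTildePoly_eq_ofGrassmann, sortProd_pTildePoly_eq_ofGrassmann, ← map_mul,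
    topCoeff_ofGrassmann, hw, hw, ← map_mul, topForm_map_vecMulLinear, det_powMatrix]
  rfl

/-- Multiplying by the complementary product and taking the top coefficient isolates `c K`, times a
sign and the nonzero Vandermonde determinant. -/
theorem eq_zero_of_sum_smul_sortProd_eq_zero [IsDomain A]
    (c : Finset (Fin N) → MvPolynomial (Fin N) A)
    (h : ∑ K, c K • sortProd (fun k : Fin N => pTildePoly A k N) K = 0) (K : Finset (Fin N)) :
    c K = 0 := by
  have h1 := congrArg
    (fun f => topCoeff A N (sortProd (fun k : Fin N => pTildePoly A k N) Kᶜ * f)) h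
  simp only [Finset.mul_sum, map_sum, mul_zero, map_zero, mul_smul_comm, map_smul] at h1
  rw [Finset.sum_eq_single K, topCoeff_sortProd_compl_mul_self, smul_eq_mul] at h1
  · have h2 : complSign (MvPolynomial (Fin N) A) K ≠ 0 :=
      left_ne_zero_of_mul_eq_one (complSign_mul_self K)
    simpa [det_vandermonde_X_ne_zero, h2] using h1
  · intro L _ hL
    rw [topCoeff_sortProd_compl_mul_sortProd hL.symm, smul_zero]
  · simp

end Super

/-! ## Alternating polynomials -/

section Alternating

variable {A : Type*} [CommRing A] {N : ℕ}

/-- The substitution `x_j = x_i`. -/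
def mergeVar (A : Type*) [CommRing A] {N : ℕ} (i j : Fin N) :
    MvPolynomial (Fin N) A →ₐ[A] MvPolynomial (Fin N) A :=
  MvPolynomial.rename fun k => if k = j then i else k

/-- The factor theorem for x_j - x_i: the substitution x_j = x_i changes each variable by a multiple
of this difference. -/
theorem X_sub_X_dvd_sub_mergeVar (i j : Fin N) (g : MvPolynomial (Fin N) A) :
    MvPolynomial.X j - MvPolynomial.X i ∣ g - mergeVar A i j g := by
  induction g using MvPolynomial.induction_on with
  | C a => simp [mergeVar]
  | add p q hp hq =>
    rw [map_add, add_sub_add_comm]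
    exact dvd_add hp hq
  | mul_X p k hp =>
    have hk : (MvPolynomial.X j - MvPolynomial.X i : MvPolynomial (Fin N) A) ∣
        MvPolynomial.X k - mergeVar A i j (MvPolynomial.X k) := by
      rw [mergeVar, MvPolynomial.rename_X]
      split_ifs with h
      · rw [h]
      · simp
    have : p * MvPolynomial.X k - mergeVar A i j (p * MvPolynomial.X k) =
        p * (MvPolynomial.X k - mergeVar A i j (MvPolynomial.X k)) +
          (p - mergeVar A i j p) * mergeVar A i j (MvPolynomial.X k) := by
      rw [map_mul]
      ring
    rw [this]
    exact dvd_add (hk.mul_left _) (hp.mul_right _)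

theorem mergeVar_rename_swap (i j : Fin N) (g : MvPolynomial (Fin N) A) :
    mergeVar A i j (MvPolynomial.rename (Equiv.swap i j) g) = mergeVar A i j g := by
  rw [mergeVar, MvPolynomial.rename_rename]
  congr 2
  ext1 k
  simp only [Function.comp_apply, Equiv.swap_apply_def]
  split_ifs <;> simp_all

/-- After the substitution x_j = x_i the transposition of i and j acts trivially, so the result
equals its own negative and vanishes in characteristic zero. -/
theorem X_sub_X_dvd_of_alternating [IsDomain A] [CharZero A] {i j : Fin N} (hij : i ≠ j)
    {g : MvPolynomial (Fin N) A}
    (hg : ∀ σ : Equiv.Perm (Fin N), g = (Equiv.Perm.sign σ : ℤ) * MvPolynomial.rename σ g) :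
    MvPolynomial.X j - MvPolynomial.X i ∣ g := by
  have h := congrArg (mergeVar A i j) (hg (Equiv.swap i j))
  rw [Equiv.Perm.sign_swap hij, map_mul, mergeVar_rename_swap] at h
  have h0 : mergeVar A i j g = 0 := by
    simpa [self_eq_neg] using h
  simpa [h0] using X_sub_X_dvd_sub_mergeVar i j g

theorem irreducible_X_sub_X [IsDomain A] {i j : Fin N} (hij : i ≠ j) :
    Irreducible (MvPolynomial.X j - MvPolynomial.X i : MvPolynomial (Fin N) A) := by
  have h := MvPolynomial.irreducible_mul_X_add (1 : MvPolynomial (Fin N) A) (-MvPolynomial.X i) j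
    one_ne_zero (by simp) (by simp [MvPolynomial.vars_neg, hij.symm]) isRelPrime_one_left
  rwa [one_mul, ← sub_eq_add_neg] at h

theorem not_X_sub_X_dvd [IsDomain A] {i j k l : Fin N} (hij : i < j) (hkl : k < l)
    (h : (i, j) ≠ (k, l)) : ¬ (MvPolynomial.X j - MvPolynomial.X i : MvPolynomial (Fin N) A) ∣
      MvPolynomial.X l - MvPolynomial.X k := by
  rintro ⟨q, hq⟩
  have h1 := congrArg (mergeVar A i j) hq
  rw [map_mul, map_sub, map_sub] at h1
  simp only [mergeVar, MvPolynomial.rename_X, if_true, hij.ne, if_false, sub_self, zero_mul,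
    sub_eq_zero] at h1
  have h2 := MvPolynomial.X_injective h1
  split_ifs at h2 <;> subst_vars <;> first | omega | simp_all

theorem vandermonde_dvd_of_alternating [IsDomain A] [CharZero A] [UniqueFactorizationMonoid A]
    {g : MvPolynomial (Fin N) A}
    (hg : ∀ σ : Equiv.Perm (Fin N), g = (Equiv.Perm.sign σ : ℤ) * MvPolynomial.rename σ g) :
    (Matrix.vandermonde (MvPolynomial.X : Fin N → MvPolynomial (Fin N) A)).det ∣ g := by
  rw [Matrix.det_vandermonde, Finset.prod_sigma']
  refine Finset.prod_dvd_of_isRelPrime ?_ ?_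
  · rintro ⟨i, j⟩ hij ⟨k, l⟩ hkl hne
    simp only [coe_sigma, Set.mem_sigma_iff, coe_univ, Set.mem_univ, true_and, coe_Ioi,
      Set.mem_Ioi] at hij hkl
    refine (irreducible_X_sub_X hij.ne).isRelPrime_iff_not_dvd.mpr (not_X_sub_X_dvd hij hkl ?_)
    rintro h
    simp only [Prod.mk.injEq] at h
    exact hne (by rw [h.1, h.2])
  · rintro ⟨i, j⟩ hij
    simp only [mem_sigma, mem_univ, true_and, mem_Ioi] at hij
    exact X_sub_X_dvd_of_alternating hij.ne hg

theorem totalDegree_det_vandermonde_X [IsDomain A] :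
    (Matrix.vandermonde (MvPolynomial.X : Fin N → MvPolynomial (Fin N) A)).det.totalDegree =
      ∑ k : Fin N, (k : ℕ) := by
  refine MvPolynomial.IsHomogeneous.totalDegree ?_ det_vandermonde_X_ne_zero
  -- Both sides count the pairs i < j; for fixed j there are j of them.
  have h : ∑ k : Fin N, (k : ℕ) = ∑ i : Fin N, ∑ j ∈ Ioi i, 1 := by
    rw [Finset.sum_comm' (t' := univ) (s' := fun j => Iio j) (by simp)]
    simp
  rw [h, Matrix.det_vandermonde]
  refine MvPolynomial.IsHomogeneous.prod _ _ _ fun i _ =>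
    MvPolynomial.IsHomogeneous.prod _ _ _ fun j _ => ?_
  exact (MvPolynomial.isHomogeneous_X A j).sub (MvPolynomial.isHomogeneous_X A i)

end Alternating

/-! ## The degree in the commuting variables -/

section Degree

variable {A : Type*} [CommRing A] {N : ℕ}

/-- The superpolynomials of degree at most `d` in the `x_i`. -/
def xDegLE (A : Type*) [CommRing A] (N d : ℕ) : Submodule A (SuperPoly A N) :=
  Submodule.span A {f | ∃ (p : MvPolynomial (Fin N) A) (w : ExteriorAlgebra A (Fin N → A)),
    p.totalDegree ≤ d ∧ f = p ⊗ₜ[A] w}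

theorem tmul_mem_xDegLE {d : ℕ} {p : MvPolynomial (Fin N) A} (hp : p.totalDegree ≤ d)
    (w : ExteriorAlgebra A (Fin N → A)) : p ⊗ₜ[A] w ∈ xDegLE A N d :=
  Submodule.subset_span ⟨p, w, hp, rfl⟩

theorem degLE_le_xDegLE (d : ℕ) : degLE A N d ≤ xDegLE A N d := by
  refine Submodule.span_mono ?_
  rintro f ⟨p, w, hp, -, rfl⟩
  exact ⟨p, w, hp, rfl⟩

theorem mul_mem_xDegLE {d d' : ℕ} {f g : SuperPoly A N} (hf : f ∈ xDegLE A N d)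
    (hg : g ∈ xDegLE A N d') : f * g ∈ xDegLE A N (d + d') := by
  have h := Submodule.mul_mem_mul hf hg
  rw [xDegLE, xDegLE, Submodule.span_mul_span] at h
  refine Submodule.span_mono ?_ h
  rintro _ ⟨_, ⟨p, w, hp, rfl⟩, _, ⟨q, v, hq, rfl⟩, rfl⟩
  exact ⟨p * q, w * v, (MvPolynomial.totalDegree_mul p q).trans (add_le_add hp hq),
    by simp [Algebra.TensorProduct.tmul_mul_tmul]⟩

theorem pTildePoly_mem_xDegLE (k : ℕ) : pTildePoly A k N ∈ xDegLE A N k :=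
  Submodule.sum_mem _ fun i _ => tmul_mem_xDegLE (totalDegree_X_pow_le i k) _

theorem sortProd_mem_xDegLE {I : Type*} [LinearOrder I] (w : I → SuperPoly A N) (d : I → ℕ)
    (h : ∀ i, w i ∈ xDegLE A N (d i)) (K : Finset I) :
    sortProd w K ∈ xDegLE A N (∑ i ∈ K, d i) := by
  have hl : ∀ l : List I, (l.map w).prod ∈ xDegLE A N (l.map d).sum := by
    intro l
    induction l with
    | nil =>
      change (1 : SuperPoly A N) ∈ xDegLE A N 0
      rw [Algebra.TensorProduct.one_def]
      exact tmul_mem_xDegLE (by simp) _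
    | cons a l ih =>
      rw [List.map_cons, List.map_cons, List.prod_cons, List.sum_cons]
      exact mul_mem_xDegLE (h a) ih
  have hs : (K.sort.map d).sum = ∑ i ∈ K, d i := by
    rw [Finset.sum, ← Finset.sort_eq K (· ≤ ·), Multiset.map_coe, Multiset.sum_coe]
  rw [← hs]
  exact hl _

theorem totalDegree_topCoeff_le {d : ℕ} {f : SuperPoly A N} (hf : f ∈ xDegLE A N d) :
    (topCoeff A N f).totalDegree ≤ d := by
  induction hf using Submodule.span_induction with
  | mem f hf =>
    obtain ⟨p, w, hp, rfl⟩ := hf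
    rw [topCoeff_tmul]
    exact (MvPolynomial.totalDegree_smul_le _ _).trans hp
  | zero => simp
  | add f g _ _ hf hg =>
    rw [map_add]
    exact (MvPolynomial.totalDegree_add _ _).trans (max_le hf hg)
  | smul a f _ hf =>
    have : topCoeff A N (a • f) = a • topCoeff A N f :=
      (topCoeff A N).map_smul_of_tower a f
    rw [this]
    exact (MvPolynomial.totalDegree_smul_le _ _).trans hf

end Degree

/-! ## Invariant superpolynomials -/

section Invariant

variable {A : Type*} [CommRing A] {N : ℕ}

theorem smul_eq_tmul_mul (p : MvPolynomial (Fin N) A) (f : SuperPoly A N) :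
    p • f = (p ⊗ₜ[A] 1) * f := by
  rw [← one_mul f, ← smul_mul_assoc, one_mul, Algebra.TensorProduct.one_def,
    TensorProduct.smul_tmul', smul_eq_mul, mul_one]

theorem permAct_smul (σ : Equiv.Perm (Fin N)) (p : MvPolynomial (Fin N) A) (f : SuperPoly A N) :
    permAct A σ (p • f) = MvPolynomial.rename σ p • permAct A σ f := by
  rw [smul_eq_tmul_mul, smul_eq_tmul_mul, map_mul]
  congr 1
  rw [permAct, Algebra.TensorProduct.map_tmul, map_one]

theorem permAct_sortProd (σ : Equiv.Perm (Fin N)) (K : Finset (Fin N)) :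
    permAct A σ (sortProd (fun k : Fin N => pTildePoly A k N) K) =
      sortProd (fun k : Fin N => pTildePoly A k N) K := by
  rw [map_sortProd]
  congr 1
  ext1 k
  exact (pTildePoly_mem (A := A) k).1 N σ

/-- Every invariant superpolynomial is a combination of products of fermionic power sums with
symmetric coefficients (Solomon's theorem). -/
theorem exists_symmetric_expansion [IsDomain A] [CharZero A] [UniqueFactorizationMonoid A]
    {d : ℕ} {f : SuperPoly A N} (hf : ∀ σ, permAct A σ f = f) (hd : f ∈ xDegLE A N d) :
    ∃ c : Finset (Fin N) → MvPolynomial (Fin N) A, (∀ K, (c K).IsSymmetric) ∧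
      (∀ K, c K ≠ 0 → ∑ k ∈ K, (k : ℕ) + (c K).totalDegree ≤ d) ∧
      f = ∑ K, c K • sortProd (fun k : Fin N => pTildePoly A k N) K := by
  set V := (Matrix.vandermonde (MvPolynomial.X : Fin N → MvPolynomial (Fin N) A)).det with hV
  have hV0 : V ≠ 0 := det_vandermonde_X_ne_zero
  have hdvd : ∀ K : Finset (Fin N),
      V ∣ topCoeff A N (sortProd (fun k : Fin N => pTildePoly A k N) Kᶜ * f) := by
    intro K
    refine vandermonde_dvd_of_alternating fun σ => ?_
    rw [← topCoeff_permAct, map_mul (permAct A σ), hf, permAct_sortProd]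
  choose q hq using hdvd
  have hsq : ∀ K : Finset (Fin N), complSign (MvPolynomial (Fin N) A) K = 1 ∨
      complSign (MvPolynomial (Fin N) A) K = -1 := fun K =>
    mul_self_eq_one_iff.mp (complSign_mul_self K)
  have hfree : Module.Free (MvPolynomial (Fin N) A) (SuperPoly A N) := by
    have := Module.Free.of_basis (Pi.basisFun A (Fin N)).ExteriorAlgebra
    infer_instance
  let c : Finset (Fin N) → MvPolynomial (Fin N) A := fun K => complSign _ K * q K
  have hfc : f = ∑ K, c K • sortProd (fun k : Fin N => pTildePoly A k N) K := by
    refine smul_right_injective _ hV0 ?_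
    change V • f = V • _
    rw [hV, vandermonde_smul_eq_sum, Finset.smul_sum]
    refine Finset.sum_congr rfl fun K _ => ?_
    rw [hq K, smul_smul]
    congr 1
    simp only [c]
    ring
  refine ⟨c, fun K σ => ?_, fun K hK => ?_, hfc⟩
  -- The p̃_K are invariant, so applying σ to the expansion gives another expansion of f; uniqueness
  -- of coefficients shows that each `c K` is symmetric.
  · have h : ∑ K, (MvPolynomial.rename σ (c K)) •
        sortProd (fun k : Fin N => pTildePoly A k N) K = f := by
      refine Eq.trans ?_ (hf σ)
      rw [hfc, map_sum]
      exact Finset.sum_congr rfl fun K _ => by rw [permAct_smul, permAct_sortProd]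
    refine sub_eq_zero.mp (eq_zero_of_sum_smul_sortProd_eq_zero
      (fun K => MvPolynomial.rename σ (c K) - c K) ?_ K)
    rw [Finset.sum_congr rfl fun L _ => sub_smul (MvPolynomial.rename σ (c L)) (c L)
      (sortProd (fun k : Fin N => pTildePoly A k N) L), Finset.sum_sub_distrib, h, ← hfc, sub_self]
  · have hqK : q K ≠ 0 := right_ne_zero_of_mul hK
    have hdeg : (c K).totalDegree = (q K).totalDegree := by
      rcases hsq K with h | h <;> simp [c, h]
    -- The top coefficient of p̃_{Kᶜ} f is V times `q K` and has degree at most d plus the sum of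
    -- Kᶜ. Since V has degree equal to the sum of all indices, what remains bounds deg `q K` by d
    -- minus the sum of K.
    have h1 := totalDegree_topCoeff_le (mul_mem_xDegLE
      (sortProd_mem_xDegLE _ _ (fun k : Fin N => pTildePoly_mem_xDegLE (A := A) (N := N) k) Kᶜ)
      hd)
    rw [hq K, MvPolynomial.totalDegree_mul_of_isDomain hV0 hqK, hV,
      totalDegree_det_vandermonde_X, ← Finset.sum_add_sum_compl K] at h1
    omega

end Invariant

/-! ## Symmetric polynomials of bounded degree -/

section Symmetric

variable {A : Type*} [CommRing A] {N : ℕ}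

/-- The evaluation of `X_n` at the elementary symmetric polynomial `e_{n+1}` in `N` variables. -/
def esymmEval (A : Type*) [CommRing A] (N : ℕ) : MvPolynomial ℕ A →ₐ[A] MvPolynomial (Fin N) A :=
  MvPolynomial.aeval fun n => MvPolynomial.esymm (Fin N) A (n + 1)

theorem esymmEval_rename (q : MvPolynomial (Fin N) A) :
    esymmEval A N (MvPolynomial.rename Fin.val q) =
      (MvPolynomial.esymmAlgHom (Fin N) A N q : MvPolynomial (Fin N) A) := by
  rw [esymmEval, MvPolynomial.aeval_rename, MvPolynomial.esymmAlgHom_apply]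
  rfl

/-- Algebraic independence of e_1, …, e_N; the variable with index i stands for e_{i+1}, hence the
strict bound. -/
theorem eq_zero_of_esymmEval_eq_zero {q : MvPolynomial ℕ A} (hv : ∀ i ∈ q.vars, i < N)
    (h : esymmEval A N q = 0) : q = 0 := by
  obtain ⟨q', rfl⟩ := MvPolynomial.exists_rename_eq_of_vars_subset_range q (Fin.val : Fin N → ℕ)
    Fin.val_injective (fun i hi => ⟨⟨i, hv i (by simpa using hi)⟩, rfl⟩)
  rw [esymmEval_rename] at h
  have h1 : MvPolynomial.esymmAlgHom (Fin N) A N q' = 0 := Subtype.ext h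
  rw [(map_eq_zero_iff _ (MvPolynomial.esymmAlgHom_fin_injective A le_rfl)).mp h1, map_zero]

theorem isHomogeneous_esymm (n : ℕ) : (MvPolynomial.esymm (Fin N) A n).IsHomogeneous n := by
  rw [MvPolynomial.esymm]
  refine MvPolynomial.IsHomogeneous.sum _ _ _ fun s hs => ?_
  have := MvPolynomial.IsHomogeneous.prod s (fun i => (MvPolynomial.X i : MvPolynomial (Fin N) A))
    (fun _ => 1) fun i _ => MvPolynomial.isHomogeneous_X A i
  simpa [(mem_powersetCard.mp hs).2] using this

theorem isHomogeneous_esymmEval {q : MvPolynomial ℕ A} {n : ℕ}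
    (hq : MvPolynomial.IsWeightedHomogeneous (fun i : ℕ => i + 1) q n) :
    (esymmEval A N q).IsHomogeneous n := by
  rw [esymmEval, MvPolynomial.aeval_def, MvPolynomial.eval₂_eq]
  refine MvPolynomial.IsHomogeneous.sum _ _ _ fun m hm => ?_
  have h1 := hq (MvPolynomial.mem_support_iff.mp hm)
  have h2 := MvPolynomial.IsHomogeneous.prod m.support
    (fun i => (MvPolynomial.esymm (Fin N) A (i + 1)) ^ m i) (fun i => (i + 1) * m i)
    fun i _ => (isHomogeneous_esymm (i + 1)).pow (m i)
  rw [MvPolynomial.algebraMap_eq]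
  convert h2.C_mul (MvPolynomial.coeff m q) using 1
  rw [← h1, Finsupp.weight_apply, Finsupp.sum]
  exact Finset.sum_congr rfl fun i _ => by rw [smul_eq_mul, mul_comm]

theorem homogeneousComponent_esymmEval (q : MvPolynomial ℕ A) (n : ℕ) :
    MvPolynomial.homogeneousComponent n (esymmEval A N q) =
      esymmEval A N (MvPolynomial.weightedHomogeneousComponent (fun i : ℕ => i + 1) n q) := by
  nth_rewrite 1 [← MvPolynomial.sum_weightedHomogeneousComponent (fun i : ℕ => i + 1) q]
  have hf := MvPolynomial.weightedHomogeneousComponent_finsupp (w := fun i : ℕ => i + 1) q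
  have hm := fun m => MvPolynomial.weightedHomogeneousComponent_isWeightedHomogeneous
    (w := fun i : ℕ => i + 1) m q
  rw [finsum_eq_sum _ hf, map_sum, map_sum]
  rw [Finset.sum_congr rfl fun m _ => MvPolynomial.homogeneousComponent_of_mem (m := n)
    (isHomogeneous_esymmEval (N := N) (hm m))]
  rw [Finset.sum_ite_eq]
  split_ifs with h
  · rfl
  · have h0 : MvPolynomial.weightedHomogeneousComponent (fun i : ℕ => i + 1) n q = 0 := by
      by_contra h0
      exact h (hf.mem_toFinset.mpr h0)
    rw [h0, map_zero]

/-- A symmetric polynomial of degree at most `d` is a polynomial in the `e_n` that has degree at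
most `d` in any number of variables. -/
theorem exists_esymmEval_eq {c : MvPolynomial (Fin N) A} (hc : c.IsSymmetric) :
    ∃ q : MvPolynomial ℕ A, esymmEval A N q = c ∧
      ∀ M, (esymmEval A M q).totalDegree ≤ c.totalDegree := by
  obtain ⟨q', hq'⟩ := (MvPolynomial.esymmAlgHom_fin_bijective (R := A) N).2 ⟨c, hc⟩
  set q := MvPolynomial.rename Fin.val q'
  have hq : esymmEval A N q = c := by rw [esymmEval_rename, hq']
  -- Give the variable with index i the weight i + 1. Truncating q at weight deg c does not change
  -- its value in N variables, and bounds the degree of its value in any number of variables.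
  refine ⟨∑ n ∈ range (c.totalDegree + 1),
    MvPolynomial.weightedHomogeneousComponent (fun i : ℕ => i + 1) n q, ?_, fun M => ?_⟩
  · rw [map_sum]
    simp only [← homogeneousComponent_esymmEval, hq]
    exact MvPolynomial.sum_homogeneousComponent c
  · rw [map_sum]
    refine MvPolynomial.totalDegree_finsetSum_le fun n hn => ?_
    refine (isHomogeneous_esymmEval
      (MvPolynomial.weightedHomogeneousComponent_isWeightedHomogeneous _ _)).totalDegree_le.trans ?_
    simpa [Nat.lt_succ_iff] using hn

/-- Setting the last variable to zero. -/
def restrPoly (A : Type*) [CommRing A] (N : ℕ) :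
    MvPolynomial (Fin (N + 1)) A →ₐ[A] MvPolynomial (Fin N) A :=
  MvPolynomial.aeval (Fin.snoc (α := fun _ => MvPolynomial (Fin N) A) MvPolynomial.X 0)

theorem X_last_dvd_sub_restrPoly (g : MvPolynomial (Fin (N + 1)) A) :
    MvPolynomial.X (Fin.last N) ∣ g - MvPolynomial.rename Fin.castSucc (restrPoly A N g) := by
  induction g using MvPolynomial.induction_on with
  | C a => simp [restrPoly]
  | add p q hp hq =>
    rw [map_add, map_add, add_sub_add_comm]
    exact dvd_add hp hq
  | mul_X p k hp =>
    have hk : (MvPolynomial.X (Fin.last N) : MvPolynomial (Fin (N + 1)) A) ∣ MvPolynomial.X k -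
        MvPolynomial.rename Fin.castSucc (restrPoly A N (MvPolynomial.X k)) := by
      induction k using Fin.lastCases with
      | last => simp [restrPoly]
      | cast k => simp [restrPoly]
    have : p * MvPolynomial.X k -
        MvPolynomial.rename Fin.castSucc (restrPoly A N (p * MvPolynomial.X k)) =
        p * (MvPolynomial.X k -
          MvPolynomial.rename Fin.castSucc (restrPoly A N (MvPolynomial.X k))) +
        (p - MvPolynomial.rename Fin.castSucc (restrPoly A N p)) *
          MvPolynomial.rename Fin.castSucc (restrPoly A N (MvPolynomial.X k)) := by
      rw [map_mul, map_mul]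
      ring
    rw [this]
    exact dvd_add (hk.mul_left _) (hp.mul_right _)

/-- Divisibility by the last variable becomes, by symmetry, divisibility by the product of all N + 1
variables, which exceeds the degree bound. -/
theorem eq_zero_of_restrPoly_eq_zero [IsDomain A] [UniqueFactorizationMonoid A]
    {c : MvPolynomial (Fin (N + 1)) A} (hc : c.IsSymmetric) (hd : c.totalDegree ≤ N)
    (h : restrPoly A N c = 0) : c = 0 := by
  by_contra hc0
  have hlast : MvPolynomial.X (Fin.last N) ∣ c := by
    simpa [h] using X_last_dvd_sub_restrPoly c
  have hX : ∀ i : Fin (N + 1), MvPolynomial.X i ∣ c := by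
    intro i
    have := map_dvd (MvPolynomial.rename (Equiv.swap (Fin.last N) i)) hlast
    rwa [hc, MvPolynomial.rename_X, Equiv.swap_apply_left] at this
  have hp : ∀ i : Fin (N + 1), Irreducible (MvPolynomial.X i : MvPolynomial (Fin (N + 1)) A) :=
    fun i => (MvPolynomial.X_prime).irreducible
  have hprod : ∏ i : Fin (N + 1), MvPolynomial.X i ∣ c := by
    refine Finset.prod_dvd_of_isRelPrime (fun i _ j _ hij => ?_) fun i _ => hX i
    refine (hp i).isRelPrime_iff_not_dvd.mpr ?_
    rwa [MvPolynomial.X_dvd_X]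
  obtain ⟨q, rfl⟩ := hprod
  have h1 : (∏ i : Fin (N + 1), MvPolynomial.X i : MvPolynomial (Fin (N + 1)) A).totalDegree =
      N + 1 := by
    have := MvPolynomial.IsHomogeneous.prod univ
      (fun i => (MvPolynomial.X i : MvPolynomial (Fin (N + 1)) A)) (fun _ => 1)
      fun i _ => MvPolynomial.isHomogeneous_X A i
    simpa using this.totalDegree (left_ne_zero_of_mul hc0)
  rw [MvPolynomial.totalDegree_mul_of_isDomain (left_ne_zero_of_mul hc0)
    (right_ne_zero_of_mul hc0), h1] at hd
  omega

end Symmetric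

/-! ## Expansions indexed by finite sets of natural numbers -/

section Expansion

variable {A : Type*} [CommRing A] {N : ℕ}

theorem sortProd_map_valEmbedding {B : Type*} [Monoid B] (w : ℕ → B) (K : Finset (Fin N)) :
    sortProd w (K.map Fin.valEmbedding) = sortProd (fun k : Fin N => w k) K := by
  have h : K.sort.map Fin.valEmbedding = (K.map Fin.valEmbedding).sort :=
    Finset.map_sort _ _ _ _ fun a _ b _ => Iff.rfl
  rw [sortProd, ← h, List.map_map]
  rfl

theorem filter_map_valEmbedding {K : Finset ℕ} (hK : K ⊆ range N) :
    (univ.filter fun i : Fin N => (i : ℕ) ∈ K).map Fin.valEmbedding = K := by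
  ext k
  simp only [mem_map, mem_filter, mem_univ, true_and, Fin.valEmbedding_apply]
  exact ⟨by rintro ⟨i, hi, rfl⟩; exact hi, fun hk => ⟨⟨k, mem_range.mp (hK hk)⟩, hk, rfl⟩⟩

theorem sum_powerset_range {M : Type*} [AddCommMonoid M] (g : Finset ℕ → M) :
    ∑ K ∈ (range N).powerset, g K = ∑ K : Finset (Fin N), g (K.map Fin.valEmbedding) := by
  symm
  refine Finset.sum_nbij (fun K => K.map Fin.valEmbedding) (fun K _ => ?_)
    (fun K _ L _ h => Finset.map_injective _ h) (fun K hK => ?_) fun _ _ => rfl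
  · rw [mem_powerset]
    intro k hk
    obtain ⟨i, -, rfl⟩ := mem_map.mp hk
    exact mem_range.mpr i.isLt
  · exact ⟨_, mem_coe.mpr (mem_univ _), filter_map_valEmbedding (mem_powerset.mp (mem_coe.mp hK))⟩

theorem eq_zero_of_sum_powerset_eq_zero [IsDomain A] (c : Finset ℕ → MvPolynomial (Fin N) A)
    (h : ∑ K ∈ (range N).powerset, c K • sortProd (fun k => pTildePoly A k N) K = 0)
    {K : Finset ℕ} (hK : K ⊆ range N) : c K = 0 := by
  rw [sum_powerset_range] at h
  simp only [sortProd_map_valEmbedding] at h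
  have := eq_zero_of_sum_smul_sortProd_eq_zero (fun K => c (K.map Fin.valEmbedding)) h
    (univ.filter fun i : Fin N => (i : ℕ) ∈ K)
  rwa [filter_map_valEmbedding hK] at this

theorem exists_symmetric_expansion_powerset [IsDomain A] [CharZero A]
    [UniqueFactorizationMonoid A] {d : ℕ} {f : SuperPoly A N} (hf : ∀ σ, permAct A σ f = f)
    (hd : f ∈ xDegLE A N d) :
    ∃ c : Finset ℕ → MvPolynomial (Fin N) A, (∀ K, (c K).IsSymmetric) ∧
      (∀ K, c K ≠ 0 → K ⊆ range N ∧ ∑ k ∈ K, k + (c K).totalDegree ≤ d) ∧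
      f = ∑ K ∈ (range N).powerset, c K • sortProd (fun k => pTildePoly A k N) K := by
  obtain ⟨c, hs, hc, hfc⟩ := exists_symmetric_expansion hf hd
  refine ⟨fun K => if K ⊆ range N then c (univ.filter fun i : Fin N => (i : ℕ) ∈ K) else 0,
    fun K => ?_, fun K hK => ?_, ?_⟩
  · beta_reduce
    split_ifs
    · exact hs _
    · exact MvPolynomial.IsSymmetric.zero
  · by_cases h : K ⊆ range N
    · simp only [if_pos h] at hK ⊢
      refine ⟨h, ?_⟩
      have h1 := hc _ hK
      have h2 : ∑ k ∈ K, k = ∑ k ∈ univ.filter fun i : Fin N => (i : ℕ) ∈ K, (k : ℕ) := by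
        conv_lhs => rw [← filter_map_valEmbedding h]
        rw [Finset.sum_map]
        rfl
      rwa [h2]
    · simp [h] at hK
  · rw [sum_powerset_range, hfc]
    refine Finset.sum_congr rfl fun K _ => ?_
    have h : K.map Fin.valEmbedding ⊆ range N := by
      intro k hk
      obtain ⟨i, -, rfl⟩ := mem_map.mp hk
      exact mem_range.mpr i.isLt
    beta_reduce
    rw [sortProd_map_valEmbedding, if_pos h]
    congr 2
    ext i
    simp [Fin.val_inj]

theorem restr_smul (p : MvPolynomial (Fin (N + 1)) A) (f : SuperPoly A (N + 1)) :
    restr A N (p • f) = restrPoly A N p • restr A N f := by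
  rw [smul_eq_tmul_mul, smul_eq_tmul_mul, map_mul]
  congr 1
  rw [restr, Algebra.TensorProduct.map_tmul, map_one]
  rfl

theorem restr_sortProd (K : Finset ℕ) :
    restr A N (sortProd (fun k => pTildePoly A k (N + 1)) K) =
      sortProd (fun k => pTildePoly A k N) K := by
  rw [map_sortProd]
  congr 1
  ext1 k
  exact (pTildePoly_mem (A := A) k).2.1 N

/-- An invariant superpolynomial of small degree is determined by its restriction. -/
theorem eq_zero_of_restr_eq_zero [IsDomain A] [CharZero A] [UniqueFactorizationMonoid A]
    {d : ℕ} (hN : d < N) {f : SuperPoly A (N + 1)} (hf : ∀ σ, permAct A σ f = f)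
    (hd : f ∈ xDegLE A (N + 1) d) (h : restr A N f = 0) : f = 0 := by
  obtain ⟨c, hs, hc, hfc⟩ := exists_symmetric_expansion_powerset hf hd
  -- This is where d < N enters: every index in K is at most d, so p̃_N does not occur and the
  -- remaining products stay independent after restriction to N pairs of variables.
  have hsub : ∀ K, c K ≠ 0 → K ⊆ range N := by
    intro K hK k hk
    have h1 := (hc K hK).2
    have h2 := Finset.single_le_sum (f := fun k : ℕ => k) (fun _ _ => Nat.zero_le _) hk
    rw [mem_range]
    omega
  have hz : ∀ K, K ⊆ range N → restrPoly A N (c K) = 0 := by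
    intro K hK
    refine eq_zero_of_sum_powerset_eq_zero (fun K => restrPoly A N (c K)) ?_ hK
    rw [← h, hfc, map_sum]
    refine Eq.trans ?_ (Finset.sum_congr rfl fun K _ => ((restr_smul (c K) _).trans
      (congrArg _ (restr_sortProd K))).symm)
    refine Finset.sum_subset (Finset.powerset_mono.mpr (range_mono (Nat.le_succ N))) ?_
    intro K _ hK
    have : c K = 0 := by
      by_contra h0
      exact hK (mem_powerset.mpr (hsub K h0))
    rw [this, map_zero, zero_smul]
  rw [hfc]
  refine Finset.sum_eq_zero fun K _ => ?_
  by_cases h0 : c K = 0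
  · rw [h0, zero_smul]
  · have := (hc K h0).2
    rw [eq_zero_of_restrPoly_eq_zero (hs K) (by omega) (hz K (hsub K h0)), zero_smul]

end Expansion

/-! ## Symmetric superfunctions as a free supercommutative algebra -/

section Free

variable {A : Type*} [CommRing A]

/-- The free supercommutative algebra on even generators `X_0, X_1, …` and odd generators
`θ_0, θ_1, …`. -/
abbrev FreeSuper (A : Type*) [CommRing A] : Type _ :=
  MvPolynomial ℕ A ⊗[A] ExteriorAlgebra A (ℕ →₀ A)

/-- The odd generator `θ_n`. -/
def freeTheta (A : Type*) [CommRing A] (n : ℕ) : ExteriorAlgebra A (ℕ →₀ A) :=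
  ExteriorAlgebra.ι A (Finsupp.single n 1)

/-- Specialization to `N` pairs of variables. -/
def specialize (A : Type*) [CommRing A] (N : ℕ) : SymSuper A →ₐ[A] SuperPoly A N :=
  (Pi.evalAlgHom A (fun N => SuperPoly A N) N).comp (SymSuper A).val

theorem ext_specialize {f g : SymSuper A} (h : ∀ N, specialize A N f = specialize A N g) :
    f = g :=
  Subtype.ext (funext h)

theorem specialize_powerTilde (N k : ℕ) :
    specialize A N (powerTilde A k) = pTildePoly A k N := rfl

theorem pTildePoly_mul_self (k N : ℕ) : pTildePoly A k N * pTildePoly A k N = 0 :=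
  thetaForm_mul_self fun i => MvPolynomial.X i ^ k

theorem pTildePoly_mul_add_mul (k l N : ℕ) :
    pTildePoly A k N * pTildePoly A l N + pTildePoly A l N * pTildePoly A k N = 0 := by
  have h := thetaForm_mul_self (A := A) (N := N)
    ((fun i => MvPolynomial.X i ^ k) + fun i => MvPolynomial.X i ^ l)
  rw [map_add] at h
  change (pTildePoly A k N + pTildePoly A l N) * (pTildePoly A k N + pTildePoly A l N) = 0 at h
  rw [add_mul, mul_add, mul_add, pTildePoly_mul_self, pTildePoly_mul_self, zero_add,
    add_zero] at h
  exact h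

theorem powerTilde_mul_self (k : ℕ) : powerTilde A k * powerTilde A k = 0 :=
  ext_specialize fun N => by
    rw [map_mul, map_zero, specialize_powerTilde, pTildePoly_mul_self]

theorem powerTilde_mul_add_mul (k l : ℕ) :
    powerTilde A k * powerTilde A l + powerTilde A l * powerTilde A k = 0 :=
  ext_specialize fun N => by
    simp only [map_add, map_mul, map_zero, specialize_powerTilde, pTildePoly_mul_add_mul]

/-- The homomorphism sending `X_n` to the symmetric function `b_n`. -/
def bosonHom (b : ℕ → ∀ N, MvPolynomial (Fin N) A)
    (hb : ∀ n, (fun N => b n N ⊗ₜ[A] (1 : ExteriorAlgebra A (Fin N → A))) ∈ SymSuper A) :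
    MvPolynomial ℕ A →ₐ[A] SymSuper A :=
  AlgHom.codRestrict (AlgHom.pi (R := A) (A := fun N => SuperPoly A N) fun N =>
      (Algebra.TensorProduct.includeLeft (R := A) (S := A)).comp
        (MvPolynomial.aeval fun n => b n N)) (SymSuper A) fun q => by
    induction q using MvPolynomial.induction_on with
    | C a =>
      rw [← MvPolynomial.algebraMap_eq, AlgHom.commutes]
      exact (SymSuper A).algebraMap_mem a
    | add p q hp hq =>
      rw [map_add]
      exact add_mem hp hq
    | mul_X p n hp =>
      rw [map_mul]
      refine mul_mem hp ?_
      convert hb n using 1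
      ext1 N
      simp

theorem specialize_bosonHom (b : ℕ → ∀ N, MvPolynomial (Fin N) A)
    (hb : ∀ n, (fun N => b n N ⊗ₜ[A] (1 : ExteriorAlgebra A (Fin N → A))) ∈ SymSuper A)
    (N : ℕ) (q : MvPolynomial ℕ A) :
    specialize A N (bosonHom b hb q) = (MvPolynomial.aeval (fun n => b n N) q) ⊗ₜ[A] 1 :=
  rfl

/-- The homomorphism sending `θ_n` to `s_n p̃_n`. -/
def fermionHom (s : ℕ → A) : ExteriorAlgebra A (ℕ →₀ A) →ₐ[A] SymSuper A :=
  ExteriorAlgebra.lift A ⟨Finsupp.linearCombination A fun n => s n • powerTilde A n, fun v => by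
    rw [Finsupp.linearCombination_apply, Finsupp.sum]
    refine sum_mul_self_eq_zero (B := SymSuper A) v.support
      (fun n => v n • s n • powerTilde A n) (fun i => ?_) fun i j => ?_
    · rw [smul_smul, smul_mul_smul_comm, powerTilde_mul_self, smul_zero]
    · rw [smul_smul, smul_smul, smul_mul_smul_comm, smul_mul_smul_comm, mul_comm (v j * s j),
        ← smul_add, powerTilde_mul_add_mul, smul_zero]⟩

theorem fermionHom_freeTheta (s : ℕ → A) (n : ℕ) :
    fermionHom s (freeTheta A n) = s n • powerTilde A n := by
  rw [fermionHom, freeTheta, ExteriorAlgebra.lift_ι_apply, Finsupp.linearCombination_single,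
    one_smul]

/-- The homomorphism sending `X_n` to `b_n` and `θ_n` to `s_n p̃_n`. -/
def superHom (b : ℕ → ∀ N, MvPolynomial (Fin N) A)
    (hb : ∀ n, (fun N => b n N ⊗ₜ[A] (1 : ExteriorAlgebra A (Fin N → A))) ∈ SymSuper A)
    (s : ℕ → A) : FreeSuper A →ₐ[A] SymSuper A :=
  Algebra.TensorProduct.lift (bosonHom b hb) (fermionHom s) fun q u =>
    ext_specialize fun N => by
      rw [map_mul, map_mul, specialize_bosonHom]
      -- In each number of variables the image of an even generator is a scalar from the polynomial
      -- ring, hence central.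
      exact Algebra.commutes (R := MvPolynomial (Fin N) A) (A := SuperPoly A N) _ _

theorem superHom_tmul (b : ℕ → ∀ N, MvPolynomial (Fin N) A)
    (hb : ∀ n, (fun N => b n N ⊗ₜ[A] (1 : ExteriorAlgebra A (Fin N → A))) ∈ SymSuper A)
    (s : ℕ → A) (q : MvPolynomial ℕ A) (u : ExteriorAlgebra A (ℕ →₀ A)) :
    superHom b hb s (q ⊗ₜ u) = bosonHom b hb q * fermionHom s u :=
  Algebra.TensorProduct.lift_tmul _ _ _ _ _

theorem esymm_tmul_one_mem (n : ℕ) : (fun N => MvPolynomial.esymm (Fin N) A n ⊗ₜ[A]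
    (1 : ExteriorAlgebra A (Fin N → A))) ∈ SymSuper A :=
  ePoly_mem n

/-- The homomorphism sending `X_n` to `e_{n+1}` and `θ_n` to `p̃_n`. -/
def elemHom (A : Type*) [CommRing A] : FreeSuper A →ₐ[A] SymSuper A :=
  superHom (fun n N => MvPolynomial.esymm (Fin N) A (n + 1)) 
    (fun n => esymm_tmul_one_mem (n + 1))    fun _ => 1

theorem specialize_elemHom_tmul (N : ℕ) (q : MvPolynomial ℕ A) (K : Finset ℕ) :
    specialize A N (elemHom A (q ⊗ₜ sortProd (freeTheta A) K)) =
      esymmEval A N q • sortProd (fun k => pTildePoly A k N) K := by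
  rw [elemHom, superHom_tmul, map_mul, specialize_bosonHom, map_sortProd, map_sortProd,
    smul_eq_tmul_mul]
  congr 2
  ext1 k
  rw [fermionHom_freeTheta, one_smul, specialize_powerTilde]

/-- The products of odd generators form a basis over the polynomials in the even ones. -/
def freeBasis (A : Type*) [CommRing A] :
    Module.Basis (Finset ℕ) (MvPolynomial ℕ A) (FreeSuper A) :=
  Algebra.TensorProduct.basis (MvPolynomial ℕ A)
    (Finsupp.basisSingleOne (R := A) (ι := ℕ)).ExteriorAlgebra

theorem eq_sum_freeBasis_repr (x : FreeSuper A) :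
    x = ∑ K ∈ ((freeBasis A).repr x).support,
      (freeBasis A).repr x K ⊗ₜ[A] sortProd (freeTheta A) K := by
  nth_rewrite 1 [← (freeBasis A).linearCombination_repr x]
  rw [Finsupp.linearCombination_apply, Finsupp.sum]
  refine Finset.sum_congr rfl fun K _ => ?_
  have h : (freeBasis A) K = 1 ⊗ₜ[A] sortProd (freeTheta A) K := by
    rw [freeBasis, Algebra.TensorProduct.basis_apply, basis_exteriorAlgebra_eq_sortProd]
    congr 2
  rw [h, TensorProduct.smul_tmul', smul_eq_mul, mul_one]

/-- An element involves finitely many generators. With N exceeding all their indices, independence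
of the p̃_K and of e_1, …, e_N shows that its coefficients vanish. -/
theorem elemHom_injective [IsDomain A] : Function.Injective (elemHom A) := by
  rw [injective_iff_map_eq_zero]
  intro x hx
  set c := (freeBasis A).repr x with hcdef
  obtain ⟨N, hN⟩ : ∃ N, ∀ K ∈ c.support, K ⊆ range N ∧ ∀ i ∈ (c K).vars, i < N := by
    refine ⟨(c.support.biUnion fun K => K ∪ (c K).vars).sup id + 1, fun K hK => ?_⟩
    have h : ∀ i ∈ K ∪ (c K).vars,
        i < (c.support.biUnion fun K => K ∪ (c K).vars).sup id + 1 := fun i hi =>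
      Nat.lt_succ_of_le (Finset.le_sup (f := id) (mem_biUnion.mpr ⟨K, hK, hi⟩))
    exact ⟨fun i hi => mem_range.mpr (h i (mem_union_left _ hi)),
      fun i hi => h i (mem_union_right _ hi)⟩
  have h1 := congrArg (specialize A N) hx
  rw [eq_sum_freeBasis_repr x, map_sum, map_sum, map_zero, ← hcdef] at h1
  simp only [specialize_elemHom_tmul] at h1
  rw [Finset.sum_subset (s₂ := (range N).powerset)
    (fun K hK => mem_powerset.mpr (hN K hK).1)] at h1
  · have h2 : ∀ K ∈ c.support, c K = 0 := fun K hK =>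
      eq_zero_of_esymmEval_eq_zero (hN K hK).2
        (eq_zero_of_sum_powerset_eq_zero (fun K => esymmEval A N (c K)) h1 (hN K hK).1)
    have h3 : c = 0 := by
      ext1 K
      by_cases hK : K ∈ c.support
      · exact h2 K hK
      · exact Finsupp.notMem_support_iff.mp hK
    exact (freeBasis A).repr.map_eq_zero_iff.mp h3
  · intro K _ hK
    rw [Finsupp.notMem_support_iff.mp hK, map_zero, zero_smul]

theorem smul_mem_xDegLE {N d d' : ℕ} {p : MvPolynomial (Fin N) A} (hp : p.totalDegree ≤ d)
    {f : SuperPoly A N} (hf : f ∈ xDegLE A N d') : p • f ∈ xDegLE A N (d + d') := by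
  rw [smul_eq_tmul_mul]
  exact mul_mem_xDegLE (tmul_mem_xDegLE hp _) hf

theorem xDegLE_mono {N d d' : ℕ} (h : d ≤ d') : xDegLE A N d ≤ xDegLE A N d' := by
  refine Submodule.span_mono ?_
  rintro f ⟨p, w, hp, rfl⟩
  exact ⟨p, w, hp.trans h, rfl⟩

/-- Vanishing passes down by restriction and up because restriction is injective on invariants of
x-degree at most d once N > d. -/
theorem eq_zero_of_specialize_eq_zero [IsDomain A] [CharZero A] [UniqueFactorizationMonoid A]
    {d : ℕ} {f : SymSuper A} (hd : ∀ N, specialize A N f ∈ xDegLE A N d)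
    (h : specialize A (d + 1) f = 0) : f = 0 := by
  have hr : ∀ N, restr A N (specialize A (N + 1) f) = specialize A N f := f.2.2.1
  refine ext_specialize fun N => ?_
  rw [map_zero]
  rcases le_total N (d + 1) with hN | hN
  · exact Nat.decreasingInduction (motive := fun N _ => specialize A N f = 0)
      (fun N _ ih => by rw [← hr, ih, map_zero]) h hN
  · induction N, hN using Nat.le_induction with
    | base => exact h
    | succ N hN ih =>
      exact eq_zero_of_restr_eq_zero (d := d) (by omega) (f.2.1 (N + 1)) (hd _) (by rw [hr, ih])

theorem elemHom_surjective [IsDomain A] [CharZero A] [UniqueFactorizationMonoid A] :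
    Function.Surjective (elemHom A) := by
  classical
  intro f
  obtain ⟨d, hd⟩ := f.2.2.2
  have hd' : ∀ N, specialize A N f ∈ xDegLE A N d := fun N => degLE_le_xDegLE d (hd N)
  obtain ⟨c, hs, hc, hfc⟩ := exists_symmetric_expansion_powerset (f.2.1 (d + 1)) (hd' (d + 1))
  choose q hq hqd using fun K => exists_esymmEval_eq (hs K)
  -- The expansion in d + 1 pairs of variables is lifted to all numbers of variables. Zero
  -- coefficients are dropped because the degree bound says nothing about their K.
  refine ⟨∑ K ∈ (range (d + 1)).powerset with c K ≠ 0, q K ⊗ₜ sortProd (freeTheta A) K, ?_⟩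
  rw [← sub_eq_zero]
  refine eq_zero_of_specialize_eq_zero (d := d) (fun N => ?_) ?_
  · rw [map_sub]
    refine sub_mem ?_ (hd' N)
    rw [map_sum, map_sum]
    refine Submodule.sum_mem _ fun K hK => ?_
    rw [specialize_elemHom_tmul]
    have h1 := (hc K (mem_filter.mp hK).2).2
    refine xDegLE_mono ?_ (smul_mem_xDegLE (hqd K N)
      (sortProd_mem_xDegLE _ (fun k => k) (fun k => pTildePoly_mem_xDegLE k) K))
    omega
  · rw [map_sub, sub_eq_zero, map_sum, map_sum]
    refine Eq.trans ?_ hfc.symm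
    rw [Finset.sum_filter]
    refine Finset.sum_congr rfl fun K _ => ?_
    split_ifs with h
    · rw [specialize_elemHom_tmul, hq]
    · rw [not_not.mp h, zero_smul]

/-- Symmetric superfunctions are freely generated by the `e_n` and the `p̃_n`. -/
def elemEquiv (A : Type*) [CommRing A] [IsDomain A] [CharZero A] [UniqueFactorizationMonoid A] :
    FreeSuper A ≃ₐ[A] SymSuper A :=
  AlgEquiv.ofBijective (elemHom A) ⟨elemHom_injective, elemHom_surjective⟩

theorem elem_zero : elem A 0 = 1 :=
  ext_specialize fun N => by
    rw [map_one]
    change ePoly A 0 N = 1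
    rw [ePoly, MvPolynomial.esymm_zero, Algebra.TensorProduct.one_def]

theorem elemHom_X (n : ℕ) : elemHom A (MvPolynomial.X n ⊗ₜ 1) = elem A (n + 1) :=
  ext_specialize fun N => by
    rw [elemHom, superHom_tmul, map_one, mul_one, specialize_bosonHom, MvPolynomial.aeval_X]
    rfl

theorem elemHom_freeTheta (n : ℕ) : elemHom A (1 ⊗ₜ freeTheta A n) = powerTilde A n := by
  rw [elemHom, superHom_tmul, map_one, one_mul, fermionHom_freeTheta, one_smul]

end Free

/-! ## Relations between elementary, complete and power sum functions -/

section Relations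

variable {A : Type*} [CommRing A] {N : ℕ}

theorem elemPoly_erase (i : Fin N) (n : ℕ) :
    MvPolynomial.esymm (Fin N) A (n + 1) =
      (∑ s ∈ powersetCard (n + 1) (univ.erase i), ∏ j ∈ s, MvPolynomial.X j) +
        MvPolynomial.X i * ∑ s ∈ powersetCard n (univ.erase i), ∏ j ∈ s, MvPolynomial.X j := by
  have hi : ∀ m, ∀ s ∈ powersetCard m (univ.erase i), i ∉ s := fun m s hs h => by
    simpa using (mem_powersetCard.mp hs).1 h
  rw [MvPolynomial.esymm]
  conv_lhs => rw [← insert_erase (mem_univ i)]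
  rw [powersetCard_succ_insert (by simp), sum_union, sum_image, mul_sum]
  · congr 1
    exact Finset.sum_congr rfl fun s hs => prod_insert (hi n s hs)
  · intro s hs t ht h
    have := congrArg (fun u => u.erase i) h
    simpa [erase_insert (hi n s hs), erase_insert (hi n t ht)] using this
  · rw [disjoint_left]
    intro s hs hs'
    obtain ⟨t, -, rfl⟩ := mem_image.mp hs'
    exact hi _ _ hs (mem_insert_self i t)

/-- Solving `elemPoly_erase` repeatedly for the elementary polynomial without x_i; in generating
functions, this is division by 1 + x_i t. -/
theorem elemPoly_erase_eq_sum (i : Fin N) (n : ℕ) :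
    (∑ s ∈ powersetCard n (univ.erase i), ∏ j ∈ s, MvPolynomial.X j) =
      ∑ k ∈ range (n + 1), (-1) ^ k * (MvPolynomial.X i ^ k *
        MvPolynomial.esymm (Fin N) A (n - k)) := by
  induction n with
  | zero => simp
  | succ n ih =>
    rw [sum_range_succ', eq_sub_of_add_eq (elemPoly_erase i n).symm, ih, mul_sum]
    simp only [Nat.add_sub_add_right, Nat.sub_zero, pow_zero, one_mul]
    rw [sub_eq_add_neg, add_comm, ← sum_neg_distrib]
    congr 1
    refine Finset.sum_congr rfl fun k _ => ?_
    ring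

theorem eTildePoly_eq_sum (n : ℕ) :
    eTildePoly A n N = ∑ i : Fin N,
      (∑ s ∈ powersetCard n (univ.erase i), ∏ j ∈ s, MvPolynomial.X j) ⊗ₜ[A] theta A i := by
  rw [eTildePoly, sum_filter, sum_product]
  refine Finset.sum_congr rfl fun i _ => ?_
  rw [TensorProduct.sum_tmul, ← sum_filter]
  refine Finset.sum_congr ?_ fun _ _ => rfl
  ext s
  simp [mem_powersetCard, subset_erase, and_comm]

theorem neg_one_pow_smul_tmul (k : ℕ) (p : MvPolynomial (Fin N) A)
    (u : ExteriorAlgebra A (Fin N → A)) :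
    (-1 : A) ^ k • (p ⊗ₜ[A] u) = ((-1) ^ k * p) ⊗ₜ[A] u := by
  rw [TensorProduct.smul_tmul']
  rcases Nat.even_or_odd k with hk | hk <;> simp [hk.neg_one_pow]

theorem elemTilde_eq_sum (n : ℕ) :
    elemTilde A n = ∑ k ∈ range (n + 1), (-1 : A) ^ k • (powerTilde A k * elem A (n - k)) := by
  refine ext_specialize fun N => ?_
  change eTildePoly A n N = _
  rw [eTildePoly_eq_sum, map_sum]
  simp only [map_smul, map_mul]
  change _ = ∑ k ∈ range (n + 1), (-1 : A) ^ k • (pTildePoly A k N * ePoly A (n - k) N)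
  simp only [pTildePoly, ePoly, sum_mul, smul_sum, neg_one_pow_smul_tmul, Algebra.TensorProduct.tmul_mul_tmul, mul_one]
  rw [sum_comm]
  refine Finset.sum_congr rfl fun i _ => ?_
  rw [elemPoly_erase_eq_sum, TensorProduct.sum_tmul]

/-- The complete homogeneous symmetric polynomial, the sum of all monomials of degree `n`. -/
def completePoly (A : Type*) [CommRing A] (n N : ℕ) : MvPolynomial (Fin N) A :=
  ∑ a ∈ piAntidiag univ n, ∏ i, MvPolynomial.X i ^ a i

/-- The monomial x^a arises once for each power x_i^k that divides it, with k = 0, …, a_i. This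
multiplicity explains the factor Λ_1 + 1 in h̃_n. -/
theorem sum_X_pow_mul_completePoly (i : Fin N) (n : ℕ) :
    ∑ k ∈ range (n + 1), MvPolynomial.X i ^ k * completePoly A (n - k) N =
      ∑ a ∈ piAntidiag univ n, (a i + 1) • ∏ j, MvPolynomial.X j ^ a j := by
  have h : ∀ a : Fin N → ℕ, (a i + 1) • (∏ j, MvPolynomial.X j ^ a j : MvPolynomial (Fin N) A) =
      ∑ k ∈ range (a i + 1), ∏ j, MvPolynomial.X j ^ a j := fun a => by simp
  simp only [h, completePoly, mul_sum]
  rw [Finset.sum_sigma', Finset.sum_sigma']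
  refine Finset.sum_nbij' (fun x => ⟨x.2 + Pi.single i x.1, x.1⟩)
    (fun x => ⟨x.2, x.1 - Pi.single i x.2⟩) ?_ ?_ ?_ ?_ ?_
  · rintro ⟨k, b⟩ hx
    simp only [mem_sigma, mem_range, mem_piAntidiag, mem_univ, implies_true, and_true] at hx ⊢
    refine ⟨?_, by simp⟩
    simp only [Pi.add_apply, sum_add_distrib, Finset.sum_pi_single', mem_univ, if_true, hx.2]
    omega
  · rintro ⟨a, k⟩ hx
    simp only [mem_sigma, mem_range, mem_piAntidiag, mem_univ, implies_true, and_true] at hx ⊢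
    have hle : ∀ j ∈ univ, (Pi.single i k : Fin N → ℕ) j ≤ a j := by
      intro j _
      by_cases hj : j = i
      · subst hj; simp; omega
      · simp [hj]
    have hs : ∑ j, a j = n := hx.1
    have h1 : a i ≤ ∑ j, a j := Finset.single_le_sum (fun _ _ => Nat.zero_le _) (mem_univ i)
    refine ⟨by omega, ?_⟩
    change ∑ j, (a j - (Pi.single i k : Fin N → ℕ) j) = _
    rw [Finset.sum_tsub_distrib _ hle, hs, Finset.sum_pi_single']
    simp
  · rintro ⟨k, b⟩ -
    simp
  · rintro ⟨a, k⟩ hx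
    simp only [mem_sigma, mem_range] at hx
    have : a - Pi.single i k + Pi.single i k = a := by
      ext j
      by_cases hj : j = i
      · subst hj; simp; omega
      · simp [hj]
    simp [this]
  · rintro ⟨k, b⟩ -
    simp only [Pi.add_apply, pow_add, prod_mul_distrib]
    rw [mul_comm]
    congr 1
    rw [Finset.prod_eq_single i]
    · simp
    · intro j _ hj
      simp [hj]
    · simp

theorem sum_psum_mul_completePoly (n : ℕ) :
    ∑ k ∈ range n, (∑ i : Fin N, MvPolynomial.X i ^ (k + 1)) * completePoly A (n - (k + 1)) N =
      n • completePoly A n N := by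
  -- Summed over i, the multiplicities a_i + 1 total n + N. The k = 0 terms account for N copies of
  -- h_n, which cancel below.
  have h : ∑ i : Fin N, ∑ k ∈ range (n + 1), MvPolynomial.X i ^ k * completePoly A (n - k) N =
      (n + N) • completePoly A n N := by
    simp only [sum_X_pow_mul_completePoly]
    rw [sum_comm, completePoly, smul_sum]
    refine Finset.sum_congr rfl fun a ha => ?_
    rw [← sum_smul, sum_add_distrib, (mem_piAntidiag.mp ha).1]
    simp
  rw [sum_comm, sum_range_succ'] at h
  simp only [← sum_mul, pow_zero, Nat.sub_zero] at h
  rw [add_smul] at h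
  simpa [nsmul_eq_mul] using h

/-- Exactly one partition has the given parts; hence summing m_λ over partitions counts each
monomial once. -/
theorem sum_partition_ite {M : Type*} [AddCommMonoid M] {n : ℕ} {s : Multiset ℕ}
    (hpos : ∀ k ∈ s, 0 < k) (hsum : s.sum = n) (x : M) :
    (∑ μ : n.Partition, if s = μ.parts then x else 0) = x := by
  rw [Finset.sum_eq_single ⟨s, fun {k} hk => hpos k hk, hsum⟩]
  · simp
  · intro μ _ hμ
    rw [if_neg]
    rintro rfl
    exact hμ (by ext1; rfl)
  · simp

/-! ### Monomial functions as sums over exponent vectors -/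

theorem bosonic_degree {n : ℕ} (μ : n.Partition) : (bosonic μ).degree = n := by
  simp only [Superpartition.degree, bosonic, List.sum_nil, zero_add]
  rw [← Multiset.sum_coe, Multiset.sort_eq, μ.parts_sum]

theorem oneFermion_degree (k : ℕ) {n : ℕ} (μ : n.Partition) :
    (oneFermion k μ).degree = k + n := by
  simp only [Superpartition.degree, oneFermion, List.sum_cons, List.sum_nil, add_zero]
  rw [← Multiset.sum_coe, Multiset.sort_eq, μ.parts_sum]

theorem mPoly_bosonic {n : ℕ} (μ : n.Partition) :
    mPoly A (bosonic μ) N = ∑ a ∈ piAntidiag (univ : Finset (Fin N)) n,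
      if (univ.filter fun i => 0 < a i).val.map a = μ.parts then
        (∏ i, MvPolynomial.X i ^ a i) ⊗ₜ[A] 1 else 0 := by
  rw [mPoly, ← sum_filter]
  refine Finset.sum_nbij' (fun t => t.2)
    (fun a => (⟨fun k => absurd k.2 (Nat.not_lt_zero _), fun k => absurd k.2 (Nat.not_lt_zero _)⟩,
      a)) ?_ ?_ ?_ ?_ ?_
  · rintro ⟨j, a⟩ ht
    simp only [monIndex, mem_filter, mem_product, mem_univ, true_and, bosonic_degree] at ht
    refine mem_filter.mpr ⟨ht.1, ?_⟩
    have h := ht.2.2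
    rw [show ((bosonic μ).sym : Multiset ℕ) = μ.parts from Multiset.sort_eq _ _] at h
    rw [← h]
    congr 2
    ext i
    simp only [mem_filter, mem_univ, true_and]
    exact ⟨fun h => ⟨fun k => absurd k.2 (Nat.not_lt_zero _), h⟩, fun h => h.2⟩
  · intro a ha
    have ha := mem_filter.mp ha
    simp only [monIndex, mem_filter, mem_product, mem_univ, true_and, bosonic_degree]
    refine ⟨ha.1, fun k => absurd k.2 (Nat.not_lt_zero _), ?_⟩
    rw [show ((bosonic μ).sym : Multiset ℕ) = μ.parts from Multiset.sort_eq _ _, ← ha.2]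
    congr 2
    ext i
    simp only [mem_filter, mem_univ, true_and]
    exact ⟨fun h => h.2, fun h => ⟨fun k => absurd k.2 (Nat.not_lt_zero _), h⟩⟩
  · rintro ⟨j, a⟩ -
    refine Prod.ext ?_ rfl
    ext k
    exact absurd k.2 (Nat.not_lt_zero _)
  · intro a _
    rfl
  · rintro ⟨j, a⟩ -
    congr 1

theorem specialize_complete (n : ℕ) :
    specialize A N (complete A n) = completePoly A n N ⊗ₜ[A] 1 := by
  rw [complete, map_sum]
  change ∑ μ : n.Partition, mPoly A (bosonic μ) N = _
  simp only [mPoly_bosonic]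
  rw [sum_comm, completePoly, TensorProduct.sum_tmul]
  refine Finset.sum_congr rfl fun a ha => sum_partition_ite ?_ ?_ _
  · intro k hk
    obtain ⟨i, hi, rfl⟩ := Multiset.mem_map.mp hk
    exact (mem_filter.mp (mem_val.mp hi)).2
  · change ∑ i ∈ univ.filter (fun i => 0 < a i), a i = n
    rw [← (mem_piAntidiag.mp ha).1]
    refine Finset.sum_subset (subset_univ _) fun i _ hi => ?_
    simpa using hi

theorem mPoly_oneFermion (k : ℕ) {n : ℕ} (μ : n.Partition) :
    mPoly A (oneFermion k μ) N = ∑ i : Fin N, ∑ a ∈ piAntidiag (univ : Finset (Fin N)) (k + n),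
      if a i = k ∧ (univ.filter fun j => i ≠ j ∧ 0 < a j).val.map a = μ.parts then
        (∏ j, MvPolynomial.X j ^ a j) ⊗ₜ[A] theta A i else 0 := by
  rw [mPoly, ← sum_product', ← sum_filter]
  have hall : ∀ (P : Fin (oneFermion k μ).anti.length → Prop),
      (∀ l, P l) ↔ P ⟨0, Nat.zero_lt_one⟩ := by
    intro P
    refine ⟨fun h => h _, fun h l => ?_⟩
    have hl : l.val < 1 := l.2
    have : l = ⟨0, Nat.zero_lt_one⟩ := Fin.ext (by simpa using hl)
    rwa [this]
  refine Finset.sum_nbij' (fun t => (t.1 ⟨0, Nat.zero_lt_one⟩, t.2))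
    (fun x => (⟨fun _ => x.1, fun l m _ => ?_⟩, x.2)) ?_ ?_ ?_ ?_ ?_
  · have hl : l.val < 1 := l.2
    have hm : m.val < 1 := m.2
    exact Fin.ext (by omega)
  · rintro ⟨j, a⟩ ht
    simp only [monIndex, mem_filter, mem_product, mem_univ, true_and, oneFermion_degree,
      hall] at ht ⊢
    rw [show ((oneFermion k μ).sym : Multiset ℕ) = μ.parts from Multiset.sort_eq _ _] at ht
    exact ht
  · rintro ⟨i, a⟩ ht
    simp only [monIndex, mem_filter, mem_product, mem_univ, true_and, oneFermion_degree,
      hall] at ht ⊢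
    rw [show ((oneFermion k μ).sym : Multiset ℕ) = μ.parts from Multiset.sort_eq _ _]
    exact ht
  · rintro ⟨j, a⟩ -
    refine Prod.ext ?_ rfl
    ext l
    have hl : l.val < 1 := l.2
    have : l = ⟨0, Nat.zero_lt_one⟩ := Fin.ext (by simpa using hl)
    rw [this]
    rfl
  · rintro ⟨i, a⟩ -
    rfl
  · rintro ⟨j, a⟩ -
    congr 1
    exact (List.prod_singleton)

/-- The term θ_i x^a occurs in m_Λ only for the Λ whose fermionic entry is a_i and whose other parts
are the remaining positive exponents. -/
theorem specialize_completeTilde (n : ℕ) :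
    specialize A N (completeTilde A n) = ∑ i : Fin N,
      (∑ a ∈ piAntidiag univ n, (a i + 1) • ∏ j, MvPolynomial.X j ^ a j) ⊗ₜ[A] theta A i := by
  have h1 : specialize A N (completeTilde A n) = ∑ k ∈ range (n + 1), ∑ i : Fin N,
      ∑ a ∈ piAntidiag (univ : Finset (Fin N)) n, if a i = k then
        (k + 1) • ((∏ j, MvPolynomial.X j ^ a j) ⊗ₜ[A] theta A i) else 0 := by
    rw [completeTilde, map_sum]
    refine Finset.sum_congr rfl fun k hk => ?_
    have hkn : k + (n - k) = n := by have := mem_range.mp hk; omega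
    rw [map_sum]
    simp only [map_nsmul]
    change ∑ μ : (n - k).Partition, (k + 1) • mPoly A (oneFermion k μ) N = _
    simp only [mPoly_oneFermion, hkn, smul_sum]
    rw [sum_comm]
    refine Finset.sum_congr rfl fun i _ => ?_
    rw [sum_comm]
    refine Finset.sum_congr rfl fun a ha => ?_
    by_cases hak : a i = k
    · simp only [hak, true_and, if_true, smul_ite, smul_zero]
      refine sum_partition_ite ?_ ?_ _
      · intro l hl
        obtain ⟨j, hj, rfl⟩ := Multiset.mem_map.mp hl
        exact (mem_filter.mp (mem_val.mp hj)).2.2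
      · change ∑ j ∈ univ.filter (fun j => i ≠ j ∧ 0 < a j), a j = n - k
        have h2 : ∑ j ∈ univ.filter (fun j => i ≠ j ∧ 0 < a j), a j =
            ∑ j ∈ univ.erase i, a j := by
          refine Finset.sum_subset (fun j hj => ?_) fun j hj hj' => ?_
          · simpa [eq_comm] using (mem_filter.mp hj).2.1
          · simp only [mem_filter, mem_univ, true_and, not_and, not_lt] at hj'
            exact Nat.le_zero.mp (hj' (ne_of_mem_erase hj).symm)
        have h3 := Finset.add_sum_erase univ a (mem_univ i)
        rw [(mem_piAntidiag.mp ha).1] at h3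
        omega
    · simp [hak]
  rw [h1, sum_comm]
  refine Finset.sum_congr rfl fun i _ => ?_
  rw [sum_comm, TensorProduct.sum_tmul]
  refine Finset.sum_congr rfl fun a ha => ?_
  rw [Finset.sum_ite_eq, if_pos, TensorProduct.smul_tmul']
  have h3 := Finset.single_le_sum (f := a) (fun _ _ => Nat.zero_le _) (mem_univ i)
  rw [(mem_piAntidiag.mp ha).1] at h3
  exact mem_range.mpr (by omega)

theorem completeTilde_eq_sum (n : ℕ) :
    completeTilde A n = ∑ k ∈ range (n + 1), powerTilde A k * complete A (n - k) := by
  refine ext_specialize fun N => ?_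
  rw [specialize_completeTilde, map_sum]
  simp only [map_mul, specialize_complete, specialize_powerTilde, pTildePoly, sum_mul,
    Algebra.TensorProduct.tmul_mul_tmul, mul_one]
  rw [sum_comm]
  refine Finset.sum_congr rfl fun i _ => ?_
  rw [← sum_X_pow_mul_completePoly, TensorProduct.sum_tmul]

/-! ### Newton's identities -/

theorem specialize_power_succ (n : ℕ) : specialize A N (power A (n + 1)) = pPoly A (n + 1) N := by
  rw [power, dif_neg (Nat.succ_ne_zero n)]
  rfl

theorem nsmul_complete_eq_sum (n : ℕ) :
    n • complete A n = ∑ k ∈ range n, power A (k + 1) * complete A (n - (k + 1)) := by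
  refine ext_specialize fun N => ?_
  rw [map_nsmul, map_sum]
  simp only [map_mul, specialize_complete, specialize_power_succ, pPoly,
    Algebra.TensorProduct.tmul_mul_tmul, mul_one]
  rw [← TensorProduct.sum_tmul, sum_psum_mul_completePoly, TensorProduct.smul_tmul']

theorem nsmul_elem_eq_sum (n : ℕ) :
    n • elem A n = ∑ k ∈ range n, (-1 : A) ^ k • (power A (k + 1) * elem A (n - (k + 1))) := by
  refine ext_specialize fun N => ?_
  rw [map_nsmul, map_sum]
  simp only [map_smul, map_mul, specialize_power_succ]
  change n • ePoly A n N = ∑ k ∈ range n, (-1 : A) ^ k • (pPoly A (k + 1) N * ePoly A (n - (k + 1)) N)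
  simp only [pPoly, ePoly, Algebra.TensorProduct.tmul_mul_tmul, mul_one, neg_one_pow_smul_tmul]
  have h := MvPolynomial.mul_esymm_eq_sum (Fin N) A n
  have h2 : ∑ a ∈ antidiagonal n with a.1 < n, (-1) ^ a.1 * MvPolynomial.esymm (Fin N) A a.1 *
      MvPolynomial.psum (Fin N) A a.2 = ∑ k ∈ range n, (-1) ^ (n - (k + 1)) *
        MvPolynomial.esymm (Fin N) A (n - (k + 1)) * MvPolynomial.psum (Fin N) A (k + 1) := by
    refine Finset.sum_nbij' (fun a => a.2 - 1) (fun k => (n - (k + 1), k + 1)) ?_ ?_ ?_ ?_ ?_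
    · rintro ⟨a, b⟩ h
      simp at h ⊢
      omega
    · intro k h
      simp at h ⊢
      omega
    · rintro ⟨a, b⟩ h
      simp at h ⊢
      omega
    · intro k h
      simp
    · rintro ⟨a, b⟩ h
      simp at h
      have e1 : b - 1 + 1 = b := by omega
      have e2 : n - b = a := by omega
      simp only [e1, e2]
  have h3 : (n : MvPolynomial (Fin N) A) * MvPolynomial.esymm (Fin N) A n =
      ∑ k ∈ range n, (-1) ^ k * ((∑ i, MvPolynomial.X i ^ (k + 1)) *
        MvPolynomial.esymm (Fin N) A (n - (k + 1))) := by
    rw [h, h2, mul_sum]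
    refine Finset.sum_congr rfl fun k hk => ?_
    have hk' := mem_range.mp hk
    -- The two exponents add up to k plus an even number.
    have e : (-1 : MvPolynomial (Fin N) A) ^ (n + 1) * (-1) ^ (n - (k + 1)) = (-1) ^ k := by
      rw [← pow_add, show n + 1 + (n - (k + 1)) = 2 * (n - k) + k by omega, pow_add, pow_mul]
      simp
    rw [← mul_assoc, ← mul_assoc, e, MvPolynomial.psum]
    ring
  rw [TensorProduct.smul_tmul', nsmul_eq_mul, h3, TensorProduct.sum_tmul]

end Relations

/-! ## The homomorphism `ω̂` -/

section Omega

variable {A : Type*} [CommRing A]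

theorem completePoly_tmul_one_mem (n : ℕ) : (fun N => completePoly A n N ⊗ₜ[A]
    (1 : ExteriorAlgebra A (Fin N → A))) ∈ SymSuper A := by
  have h := (complete A n).2
  have h' : (complete A n : ∀ N, SuperPoly A N) = fun N => completePoly A n N ⊗ₜ[A] 1 :=
    funext fun N => specialize_complete n
  rwa [h'] at h

theorem complete_zero : complete A 0 = 1 :=
  ext_specialize fun N => by
    rw [specialize_complete, map_one, Algebra.TensorProduct.one_def, completePoly,
      piAntidiag_zero, sum_singleton]
    simp

/-- The homomorphism sending `X_n` to `h_{n+1}` and `θ_n` to `(-1)^n p̃_n`. -/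
def completeHom (A : Type*) [CommRing A] : FreeSuper A →ₐ[A] SymSuper A :=
  superHom (fun n N => completePoly A (n + 1) N) (fun n => completePoly_tmul_one_mem (n + 1))
    fun n => (-1) ^ n

theorem completeHom_X (n : ℕ) : completeHom A (MvPolynomial.X n ⊗ₜ 1) = complete A (n + 1) :=
  ext_specialize fun N => by
    rw [completeHom, superHom_tmul, map_one, mul_one, specialize_bosonHom, MvPolynomial.aeval_X,
      specialize_complete]

theorem completeHom_freeTheta (n : ℕ) :
    completeHom A (1 ⊗ₜ freeTheta A n) = (-1 : A) ^ n • powerTilde A n := by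
  rw [completeHom, superHom_tmul, map_one, one_mul, fermionHom_freeTheta]

theorem neg_one_pow_smul_smul (n : ℕ) (x : SymSuper A) :
    (-1 : A) ^ n • (-1 : A) ^ n • x = x := by
  rw [smul_smul, ← mul_pow]
  simp

/-- The endomorphism of the ring of symmetric superfunctions that sends `e_n` to `h_n` and `ẽ_n`
to `h̃_n`. -/
def omegaHat (A : Type*) [CommRing A] [IsDomain A] [CharZero A] [UniqueFactorizationMonoid A] :
    SymSuper A →ₐ[A] SymSuper A :=
  (completeHom A).comp (elemEquiv A).symm.toAlgHom

section Existence

variable [IsDomain A] [CharZero A] [UniqueFactorizationMonoid A]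

theorem omegaHat_elemHom (x : FreeSuper A) : omegaHat A (elemHom A x) = completeHom A x :=
  congrArg (completeHom A) ((elemEquiv A).symm_apply_apply x)

theorem omegaHat_elem (n : ℕ) : omegaHat A (elem A n) = complete A n := by
  cases n with
  | zero => rw [elem_zero, complete_zero, map_one]
  | succ n => rw [← elemHom_X, omegaHat_elemHom, completeHom_X]

theorem omegaHat_powerTilde (n : ℕ) :
    omegaHat A (powerTilde A n) = (-1 : A) ^ n • powerTilde A n := by
  rw [← elemHom_freeTheta, omegaHat_elemHom, completeHom_freeTheta, elemHom_freeTheta]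

/-- The sign of p̃_k under ω̂ cancels the sign in the expansion of ẽ_n, leaving the expansion of
h̃_n. -/
theorem omegaHat_elemTilde (n : ℕ) : omegaHat A (elemTilde A n) = completeTilde A n := by
  rw [elemTilde_eq_sum, completeTilde_eq_sum, map_sum]
  refine Finset.sum_congr rfl fun k _ => ?_
  rw [map_smul, map_mul, omegaHat_powerTilde, omegaHat_elem, smul_mul_assoc,
    neg_one_pow_smul_smul]

end Existence

section Values

variable {ω : SymSuper A →ₐ[A] SymSuper A}

/-- By induction the terms with k < n agree in the expansions of ω(ẽ_n) and h̃_n. The last terms,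
where e_0 = h_0 = 1, then give the value on p̃_n. -/
theorem map_powerTilde_of_map_elem (he : ∀ n, ω (elem A n) = complete A n)
    (ht : ∀ n, ω (elemTilde A n) = completeTilde A n) (n : ℕ) :
    ω (powerTilde A n) = (-1 : A) ^ n • powerTilde A n := by
  induction n using Nat.strong_induction_on with
  | h n ih =>
    have h := ht n
    rw [elemTilde_eq_sum, completeTilde_eq_sum, map_sum, sum_range_succ, sum_range_succ,
      Nat.sub_self, elem_zero, complete_zero, mul_one, map_smul] at h
    have h1 : ∑ k ∈ range n, ω ((-1 : A) ^ k • (powerTilde A k * elem A (n - k))) =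
        ∑ k ∈ range n, powerTilde A k * complete A (n - k) := by
      refine Finset.sum_congr rfl fun k hk => ?_
      rw [map_smul, map_mul, ih k (mem_range.mp hk), he, smul_mul_assoc, neg_one_pow_smul_smul]
    rw [h1] at h
    exact (neg_one_pow_smul_smul n _).symm.trans
      (congrArg (fun f => (-1 : A) ^ n • f) (add_left_cancel h))

/-- The same induction with Newton's identities: p_{n+1} occurs in them with coefficient ±1, so the
factor n + 1 never has to be inverted. -/
theorem map_power_of_map_elem (he : ∀ n, ω (elem A n) = complete A n) (n : ℕ) :
    ω (power A (n + 1)) = (-1 : A) ^ n • power A (n + 1) := by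
  induction n using Nat.strong_induction_on with
  | h n ih =>
    have h : (n + 1) • ω (elem A (n + 1)) = (n + 1) • complete A (n + 1) := by rw [he]
    rw [← map_nsmul, nsmul_elem_eq_sum, nsmul_complete_eq_sum, map_sum, sum_range_succ,
      sum_range_succ, Nat.sub_self, elem_zero, complete_zero, mul_one, map_smul] at h
    have h1 : ∑ k ∈ range n,
        ω ((-1 : A) ^ k • (power A (k + 1) * elem A (n + 1 - (k + 1)))) =
        ∑ k ∈ range n, power A (k + 1) * complete A (n + 1 - (k + 1)) := by
      refine Finset.sum_congr rfl fun k hk => ?_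
      rw [map_smul, map_mul, ih k (mem_range.mp hk), he, smul_mul_assoc, neg_one_pow_smul_smul]
    rw [h1] at h
    exact (neg_one_pow_smul_smul n _).symm.trans
      (congrArg (fun f => (-1 : A) ^ n • f) (add_left_cancel h))

theorem map_listProd_of_forall {I B : Type*} [Ring B] [Algebra A B] (φ : B →ₐ[A] B) (f : I → B)
    (g : I → ℕ) (l : List I) (h : ∀ i ∈ l, φ (f i) = (-1 : A) ^ g i • f i) :
    φ (l.map f).prod = (-1 : A) ^ (l.map g).sum • (l.map f).prod := by
  induction l with
  | nil => simp
  | cons a l ih =>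
    rw [List.map_cons, List.map_cons, List.prod_cons, List.sum_cons, map_mul,
      h a List.mem_cons_self, ih fun i hi => h i (List.mem_cons_of_mem a hi),
      smul_mul_smul_comm, pow_add]

theorem sum_map_pred (l : List ℕ) (h : ∀ k ∈ l, 0 < k) :
    (l.map fun k => k - 1).sum + l.length = l.sum := by
  induction l with
  | nil => simp
  | cons a l ih =>
    have h1 := h a List.mem_cons_self
    have h2 := ih fun i hi => h i (List.mem_cons_of_mem a hi)
    simp only [List.map_cons, List.sum_cons, List.length_cons]
    omega

theorem map_powerProd_of_map_elem (he : ∀ n, ω (elem A n) = complete A n)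
    (ht : ∀ n, ω (elemTilde A n) = completeTilde A n) (Λ : Superpartition) :
    ω (powerProd A Λ) =
      (-1 : A) ^ (Λ.degree + Λ.fermionicDegree - Λ.length) • powerProd A Λ := by
  have h1 := map_listProd_of_forall ω (powerTilde A) id Λ.anti fun k _ =>
    map_powerTilde_of_map_elem he ht k
  have h2 := map_listProd_of_forall ω (power A) (fun k => k - 1) Λ.sym fun k hk => by
    obtain ⟨m, rfl⟩ := Nat.exists_eq_succ_of_ne_zero (Λ.sym_pos k hk).ne'
    exact map_power_of_map_elem he m
  have h3 := sum_map_pred Λ.sym Λ.sym_pos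
  -- Each p̃_k contributes k and each p_k contributes k - 1 to the exponent of the sign. The natural
  -- number subtraction is exact because the entries of Λ^s are positive.
  have h4 : Λ.degree + Λ.fermionicDegree - Λ.length =
      (Λ.anti.map id).sum + (Λ.sym.map fun k => k - 1).sum := by
    rw [Superpartition.degree, Superpartition.length, List.map_id]
    omega
  rw [powerProd, map_mul, h1, h2, smul_mul_smul_comm, h4, pow_add]

/-- Only surjectivity of `elemHom` is needed: the e_n and p̃_n generate. -/
theorem algHom_ext_elem [IsDomain A] [CharZero A] [UniqueFactorizationMonoid A]
    {ω' : SymSuper A →ₐ[A] SymSuper A} (he : ∀ n, ω (elem A n) = ω' (elem A n))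
    (hp : ∀ n, ω (powerTilde A n) = ω' (powerTilde A n)) : ω = ω' := by
  have h : ω.comp (elemHom A) = ω'.comp (elemHom A) := by
    refine Algebra.TensorProduct.ext ?_ ?_
    · refine MvPolynomial.algHom_ext fun n => ?_
      change ω (elemHom A (MvPolynomial.X n ⊗ₜ 1)) = ω' (elemHom A (MvPolynomial.X n ⊗ₜ 1))
      rw [elemHom_X, he]
    · refine ExteriorAlgebra.hom_ext (Finsupp.lhom_ext' fun n => LinearMap.ext_ring ?_)
      change ω (elemHom A (1 ⊗ₜ freeTheta A n)) = ω' (elemHom A (1 ⊗ₜ freeTheta A n))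
      rw [elemHom_freeTheta, hp]
  refine AlgHom.ext fun f => ?_
  obtain ⟨x, rfl⟩ := elemHom_surjective f
  exact DFunLike.congr_fun h x

end Values

/-- A ring endomorphism is a homomorphism of algebras over `ℤ`. -/
def algHomOfInt (ω : SymSuper ℤ →+* SymSuper ℤ) : SymSuper ℤ →ₐ[ℤ] SymSuper ℤ where
  __ := ω
  commutes' := DFunLike.congr_fun
    (RingHom.ext_int (ω.comp (algebraMap ℤ (SymSuper ℤ))) (algebraMap ℤ (SymSuper ℤ)))

theorem neg_one_pow_smul_eq_mul (n : ℕ) (f : SymSuper ℤ) :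
    (-1 : ℤ) ^ n • f = (-1) ^ n * f := by
  rw [Algebra.smul_def, map_pow, map_neg, map_one]

end Omega

end SuperSym

end

theorem mainTheorem5 :
    (∃! ω : SuperSym.SymSuper ℤ →+* SuperSym.SymSuper ℤ, SuperSym.IsOmegaHat ω) ∧
    ∀ ω : SuperSym.SymSuper ℤ →+* SuperSym.SymSuper ℤ, SuperSym.IsOmegaHat ω →
      (∀ n : ℕ, 0 < n →
        ω (SuperSym.power ℤ n) = (-1) ^ (n - 1) * SuperSym.power ℤ n ∧
        ω (SuperSym.powerTilde ℤ (n - 1)) = (-1) ^ (n - 1) * SuperSym.powerTilde ℤ (n - 1)) ∧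
      ∀ Λ : SuperSym.Superpartition,
        ω (SuperSym.powerProd ℤ Λ) =
          (-1) ^ (Λ.degree + Λ.fermionicDegree - Λ.length) * SuperSym.powerProd ℤ Λ := by
  refine ⟨⟨(SuperSym.omegaHat ℤ : SuperSym.SymSuper ℤ →+* SuperSym.SymSuper ℤ),
    ⟨SuperSym.omegaHat_elem, SuperSym.omegaHat_elemTilde⟩, fun ω hω => ?_⟩, fun ω hω => ?_⟩
  · have h : SuperSym.algHomOfInt ω = SuperSym.omegaHat ℤ := by
      refine SuperSym.algHom_ext_elem (fun n => ?_) fun n => ?_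
      · rw [SuperSym.omegaHat_elem]
        exact hω.1 n
      · rw [SuperSym.omegaHat_powerTilde,
          SuperSym.map_powerTilde_of_map_elem (ω := SuperSym.algHomOfInt ω) hω.1 hω.2]
    exact RingHom.ext fun f => DFunLike.congr_fun h f
  · refine ⟨fun n hn => ?_, fun Λ => ?_⟩
    · obtain ⟨m, rfl⟩ := Nat.exists_eq_succ_of_ne_zero hn.ne'
      rw [← SuperSym.neg_one_pow_smul_eq_mul, ← SuperSym.neg_one_pow_smul_eq_mul]
      exact ⟨SuperSym.map_power_of_map_elem (ω := SuperSym.algHomOfInt ω) hω.1 m,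
        SuperSym.map_powerTilde_of_map_elem (ω := SuperSym.algHomOfInt ω) hω.1 hω.2 m⟩
    · rw [← SuperSym.neg_one_pow_smul_eq_mul]
      exact SuperSym.map_powerProd_of_map_elem (ω := SuperSym.algHomOfInt ω) hω.1 hω.2 Λ
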